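/- Let $p$ be a prime, $k$ a perfect field of characteristic $p$, $F=W(k)[1/p]$ the fraction field of the ring of Witt vectors of $k$, $\overline{F}$ an algebraic closure of $F$ with the unique extension of the $p$-adic absolute value, and $\mathbf{C}$ the completion of $\overline{F}$. Let $K\subset\overline{F}$ be a finite extension of $F$ (for example a totally ramified one), and let $G_K=\operatorname{Gal}(\overline{F}/K)$, which acts on $\mathbf{C}$ by continuity. Put $K_n=K(\mu_{p^n})$, $K_\infty=\bigcup_n K_n$, $H_K=\operatorname{Gal}(\overline{F}/K_\infty)$ and $\Gamma_K=\operatorname{Gal}(K_\infty/K)=G_K/H_K$, and let $\chi:G_K\to\mathbf{Z}_p^*$ be the cyclotomic character. For a character (group homomorphism) $\eta:G_K\to\mathbf{Z}_p^*$ let $\mathbf{C}(\eta)$ denote $\mathbf{C}$ with the twisted action in which $g\in G_K$ sends $x$ to $\eta(g)\,g(x)$, and let $H^0(K,\mathbf{C}(\eta))$ be its $G_K$-invariants. Let $\psi:G_K\to\mathbf{Z}_p^*$ be a character that is trivial on $H_K$ but does not factor through a finite quotient of $\Gamma_K$ (that is, a quotient by an open normal subgroup). Then $$H^0(K,\mathbf{C}(\psi^{-1}))=\{x\in\mathbf{C}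 : g(x)=\psi(g)x \text{ for all } g\in G_K\}=\{0\}.$$ In particular, $\mathbf{C}$ contains no period for the cyclotomic character or its inverse: $H^0(K,\mathbf{C}(\chi^{-1}))=0$ and $H^0(K,\mathbf{C}(\chi))=0$. -/

import Mathlib

open scoped WittVector

noncomputable section

namespace PadicHodge

section Fields

variable (p : ℕ) [Fact p.Prime] (k : Type*) [Field k] [CharP k p] [PerfectRing k p]

/-- `F = W(k)[1/p]`, the fraction field of the ring of Witt vectors of the perfect field `k`. -/
abbrev F : Type _ := FractionRing (WittVector p k)

theorem one_lt_p : (1 : NNReal) < (p : NNReal) := by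
  exact_mod_cast (Fact.out : p.Prime).one_lt

/-- The `p`-adic absolute value on `F`, normalised by `|p| = 1/p`. -/
def padicAbv : AbsoluteValue (F p k) ℝ :=
  (IsDiscreteValuationRing.maximalIdeal (WittVector p k)).adicAbv (one_lt_p p)

instance : NormedField (F p k) := (padicAbv p k).toNormedField

theorem norm_F_def (x : F p k) : ‖x‖ = padicAbv p k x := rfl

theorem maximalIdeal_eq :
    (IsDiscreteValuationRing.maximalIdeal (WittVector p k)).asIdeal
      = Ideal.span {(p : WittVector p k)} :=
  (WittVector.irreducible p).maximalIdeal_eq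

theorem toNNReal_exp_neg (n : ℕ) :
    ((WithZeroMulInt.toNNReal (one_lt_p p).ne_zero (WithZero.exp (-(n : ℤ))) : NNReal) : ℝ)
      = ((p : ℝ)⁻¹) ^ n := by
  rw [WithZeroMulInt.toNNReal_neg_apply _ WithZero.exp_ne_zero]
  have : WithZero.unzero (WithZero.exp_ne_zero (a := (-(n : ℤ)))) = Multiplicative.ofAdd (-(n : ℤ)) :=
    WithZero.coe_injective (WithZero.coe_unzero _)
  rw [this]
  simp

theorem norm_algebraMap_le_iff (a : WittVector p k) (n : ℕ) :
    ‖algebraMap (WittVector p k) (F p k) a‖ ≤ ((p : ℝ)⁻¹) ^ n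
      ↔ a ∈ Ideal.span {(p : WittVector p k)} ^ n := by
  rw [← maximalIdeal_eq,
    ← IsDedekindDomain.HeightOneSpectrum.intValuation_le_pow_iff_mem,
    ← IsDedekindDomain.HeightOneSpectrum.valuation_of_algebraMap (K := F p k),
    ← (WithZeroMulInt.toNNReal_strictMono (one_lt_p p)).le_iff_le, ← NNReal.coe_le_coe,
    toNNReal_exp_neg]
  rfl

theorem norm_p : ‖(p : F p k)‖ = (p : ℝ)⁻¹ := by
  have h := (IsDiscreteValuationRing.maximalIdeal (WittVector p k)).intValuation_singleton
    (WittVector.irreducible p).ne_zero (maximalIdeal_eq p k)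
  rw [← IsDedekindDomain.HeightOneSpectrum.valuation_of_algebraMap (K := F p k)] at h
  have h2 := toNNReal_exp_neg p 1
  rw [Nat.cast_one, ← h, pow_one] at h2
  rw [← map_natCast (algebraMap (WittVector p k) (F p k))]
  exact h2

theorem exists_algebraMap_of_norm_le_one (x : F p k) (hx : ‖x‖ ≤ 1) :
    ∃ a, algebraMap (WittVector p k) (F p k) a = x := by
  apply IsDiscreteValuationRing.exists_lift_of_le_one
  rw [← WithZeroMulInt.toNNReal_le_one_iff (one_lt_p p)]
  exact_mod_cast hx

instance : NontriviallyNormedField (F p k) where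
  non_trivial := ⟨(p : F p k)⁻¹, by
    rw [norm_inv, norm_p, inv_inv]
    exact_mod_cast (Fact.out : p.Prime).one_lt⟩

instance : IsUltrametricDist (F p k) :=
  IsUltrametricDist.isUltrametricDist_of_forall_norm_add_le_max_norm
    (IsDedekindDomain.HeightOneSpectrum.isNonarchimedean_adicAbv _ (one_lt_p p))

instance : CompleteSpace (F p k) := by
  have hp : (1 : ℝ) < p := by exact_mod_cast (Fact.out : p.Prime).one_lt
  have hp0 : (0 : ℝ) < (p : ℝ)⁻¹ := by positivity
  have hp1 : (p : ℝ)⁻¹ < 1 := inv_lt_one_of_one_lt₀ hp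
  refine Metric.complete_of_convergent_controlled_sequences (fun n => ((p : ℝ)⁻¹) ^ n)
    (fun n => by positivity) fun u hu => ?_
  have hle : ∀ n, ‖u n - u 0‖ ≤ 1 := fun n => by
    have := hu 0 n 0 (Nat.zero_le _) le_rfl
    rw [dist_eq_norm, pow_zero] at this
    exact this.le
  choose a ha using fun n => exists_algebraMap_of_norm_le_one p k _ (hle n)
  obtain ⟨L, hL⟩ := IsPrecomplete.prec' (I := Ideal.span {(p : WittVector p k)}) a (by
    intro m n hmn
    rw [SModEq.sub_mem, smul_eq_mul, Ideal.mul_top, ← norm_algebraMap_le_iff, map_sub, ha, ha,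
      sub_sub_sub_cancel_right, ← dist_eq_norm]
    exact (hu m m n le_rfl hmn).le)
  refine ⟨algebraMap _ _ L + u 0, ?_⟩
  rw [tendsto_iff_norm_sub_tendsto_zero]
  refine squeeze_zero (fun _ => norm_nonneg _) (fun n => ?_)
    (tendsto_pow_atTop_nhds_zero_of_lt_one hp0.le hp1)
  have := hL n
  rw [SModEq.sub_mem, smul_eq_mul, Ideal.mul_top, ← norm_algebraMap_le_iff, map_sub, ha] at this
  rwa [show u n - u 0 - algebraMap (WittVector p k) (F p k) L
    = u n - (algebraMap (WittVector p k) (F p k) L + u 0) by ring] at this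

/-- The algebraic closure of `F`. It is also the algebraic closure of each finite extension `K` of
`F` inside it. -/
abbrev Fbar : Type _ := AlgebraicClosure (F p k)

/-- The unique extension of the `p`-adic absolute value of `F` to its algebraic closure. -/
instance : NormedField (Fbar p k) := spectralNorm.normedField (F p k) (Fbar p k)

/-- `C`, the completion of the algebraic closure of `F` for the `p`-adic absolute value. -/
abbrev C : Type _ := UniformSpace.Completion (Fbar p k)

/-- The embedding of `ℤ_p = W(𝔽_p)` into `W(k)`. -/
def padicIntToWitt : ℤ_[p] →+* WittVector p k :=
  (WittVector.map (ZMod.castHom (dvd_refl p) k)).comp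
    (WittVector.equiv p).symm.toRingHom

/-- The structure of `ℤ_p`-algebra on `C`, along `ℤ_p → W(k) → F → Fbar → C`. -/
instance : Algebra ℤ_[p] (C p k) :=
  ((UniformSpace.Completion.coeRingHom (α := Fbar p k)).comp
    ((algebraMap (F p k) (Fbar p k)).comp
      ((algebraMap (WittVector p k) (F p k)).comp (padicIntToWitt p k)))).toAlgebra

end Fields

section Galois

variable {p : ℕ} [Fact p.Prime] {k : Type*} [Field k] [CharP k p] [PerfectRing k p]
variable (K : IntermediateField (F p k) (Fbar p k))

/-- `G_K`, the absolute Galois group of `K`. -/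
abbrev G : Type _ := Gal(Fbar p k/K)

theorem norm_galois (g : G K) (x : Fbar p k) : ‖g • x‖ = ‖x‖ :=
  (spectralNorm_eq_of_equiv (g.restrictScalars (F p k)) x).symm

/-- Elements of `G_K` are isometries of the algebraic closure. Hence the action of `G_K` extends by
continuity to an action on the completion `C`, written `g • x`. -/
instance : UniformContinuousConstSMul (G K) (Fbar p k) where
  uniformContinuous_const_smul g := by
    have : Isometry (fun x : Fbar p k => g • x) :=
      AddMonoidHomClass.isometry_of_norm (DistribSMul.toAddMonoidHom (Fbar p k) g) (norm_galois K g)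
    exact this.uniformContinuous

theorem galois_smul_coe (g : G K) (x : Fbar p k) : g • (x : C p k) = ((g x : Fbar p k) : C p k) :=
  (UniformSpace.Completion.coe_smul g x).symm

theorem galois_smul_mul (g : G K) (x y : C p k) : g • (x * y) = (g • x) * (g • y) := by
  induction x, y using UniformSpace.Completion.induction_on₂ with
  | hp =>
    exact isClosed_eq (continuous_mul.const_smul g)
      ((continuous_fst.const_smul g).mul (continuous_snd.const_smul g))
  | ih x y =>
    rw [← UniformSpace.Completion.coe_mul, galois_smul_coe, galois_smul_coe, galois_smul_coe,
      map_mul, UniformSpace.Completion.coe_mul]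

theorem galois_smul_padicInt (g : G K) (a : ℤ_[p]) :
    g • algebraMap ℤ_[p] (C p k) a = algebraMap ℤ_[p] (C p k) a := by
  have h : ∀ y : F p k, g (algebraMap (F p k) (Fbar p k) y) = algebraMap (F p k) (Fbar p k) y :=
    (g.restrictScalars (F p k)).commutes
  exact (galois_smul_coe K g _).trans (congrArg _ (h _))

/-- The representation `C(η)` of `G_K`, for a character `η : G_K → ℤ_pˣ`: the underlying module is
`C`, and `g` acts by `x ↦ η(g) g(x)`. -/
def twist (η : G K →* ℤ_[p]ˣ) : Representation ℤ_[p] (G K) (C p k) where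
  toFun g :=
    { toFun := fun x => (η g : ℤ_[p]) • (g • x)
      map_add' := fun x y => by rw [smul_add, smul_add]
      map_smul' := fun a x => by
        simp only [Algebra.smul_def, galois_smul_mul, galois_smul_padicInt, RingHom.id_apply]
        ring }
  map_one' := by ext x; simp
  map_mul' g h := by
    ext x
    simp only [Algebra.smul_def, galois_smul_mul, galois_smul_padicInt, map_mul, Units.val_mul,
      mul_smul, LinearMap.coe_mk, AddHom.coe_mk, Module.End.mul_apply]
    ring

/-- `H⁰(K, C(η))`, the invariants of `C(η)` under `G_K`. -/
def H0 (η : G K →* ℤ_[p]ˣ) : Submodule ℤ_[p] (C p k) := (twist K η).invariants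

/-- `K_n = K(μ_{p^n})`. -/
def Kn (n : ℕ) : IntermediateField K (Fbar p k) :=
  IntermediateField.adjoin K {ζ : Fbar p k | ζ ^ p ^ n = 1}

/-- `K_∞`, the union of the `K_n`. -/
def Kinf : IntermediateField K (Fbar p k) := ⨆ n, Kn K n

instance (n : ℕ) : Normal K (Kn K n) := by
  rw [IntermediateField.normal_iff_forall_map_le]
  intro σ
  rw [Kn, IntermediateField.adjoin_map]
  refine IntermediateField.adjoin.mono _ _ _ ?_
  rintro _ ⟨ζ, hζ, rfl⟩
  change σ ζ ^ p ^ n = 1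
  rw [← map_pow, show ζ ^ p ^ n = 1 from hζ, map_one]

instance : Normal K (Kinf K) := IntermediateField.normal_iSup _ _ _

/-- `H_K`, the subgroup `Gal(Fbar/K_∞)` of `G_K`. -/
def H : Subgroup (G K) := (Kinf K).fixingSubgroup

/-- `Γ_K = Gal(K_∞/K)`, with its Krull topology. -/
abbrev Γ : Type _ := Gal(Kinf K/K)

/-- The restriction map `G_K → Γ_K`. -/
def resΓ : G K →* Γ K := AlgEquiv.restrictNormalHom (Kinf K)

/-- `ψ` factors through a finite quotient of the profinite group `Γ_K`. -/
def FactorsThroughFiniteQuotient (ψ : G K →* ℤ_[p]ˣ) : Prop :=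
  ∃ (N : Subgroup (Γ K)) (_ : N.Normal), IsOpen (N : Set (Γ K)) ∧ Finite (Γ K ⧸ N) ∧
    ∃ φ : Γ K ⧸ N →* ℤ_[p]ˣ, ψ = φ.comp ((QuotientGroup.mk' N).comp (resΓ K))

/-- The cyclotomic character `χ : G_K → ℤ_pˣ`. -/
def χ : G K →* ℤ_[p]ˣ :=
  (cyclotomicCharacter (Fbar p k) p).comp (MulSemiringAction.toRingAut (G K) (Fbar p k))

end Galois

end PadicHodge

end

/-! ### Ax's lemma: approximating an element whose conjugates are all close to it. -/

section Ax

open Polynomial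

/-! Let x ≠ 0 satisfy g(x) = ψ(g)x for all g in G_K. The claim is that ker ψ is then open
(`isOpen_ker_of_eigenvector`), so that ψ factors through a finite quotient of Γ_K. For χ and its
inverse the kernel is H_K, which is not open because F(μ_{p^∞}) has infinite degree over F.

Two tools are used over F. By Ax's lemma (`exists_approx_of_conjugates_near`), an element y of C
fixed by Gal(Fbar/F(μ_{p^∞})) is a limit of elements of F(μ_{p^∞}). Tate's normalised traces to
F(μ_{p^m}) (`exists_normalizedTrace`) are bounded by p, uniformly in the upper level, and are
compatible with the Galois action. If y ≠ 0 and m is large, the traces of close approximants of y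
have norm at least ‖y‖. An automorphism fixing F(μ_{p^m}) fixes these traces, so it cannot multiply
y by a scalar c ≠ 1 of F (`exists_level_eigenvalue_eq_one`).

Working over F keeps the tower explicit: it is totally ramified with uniformisers ζ - 1. To descend
from K to F, x is replaced by a product y of d of its translates
(`exists_smul_invariant_of_finiteIndex`). This gives ψ(g)^d = 1 on an open subgroup. If g also fixes
a good approximation of x, then ψ(g) is close to 1, and a d-th root of unity close enough to 1
equals 1. Continuity of ψ is never assumed. -/

theorem norm_natCast_eq_one_of_not_dvd {E : Type*} [NormedField E] [IsUltrametricDist E] {p : ℕ}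
    (hp : p.Prime) (hpE : ‖(p : E)‖ < 1) {n : ℕ} (hn : ¬ p ∣ n) : ‖(n : E)‖ = 1 := by
  refine le_antisymm (IsUltrametricDist.norm_natCast_le_one E n) ?_
  by_contra! hlt
  have hcop : IsCoprime (n : ℤ) (p : ℤ) :=
    Nat.isCoprime_iff_coprime.2 ((hp.coprime_iff_not_dvd.2 hn).symm)
  obtain ⟨a, b, hab⟩ := hcop
  have h1 : (a : E) * n + b * p = 1 := by exact_mod_cast congrArg (Int.cast : ℤ → E) hab
  have ha := IsUltrametricDist.norm_intCast_le_one E a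
  have hb := IsUltrametricDist.norm_intCast_le_one E b
  have h2 : ‖(a : E) * n + b * p‖ < 1 := by
    refine (IsUltrametricDist.norm_add_le_max _ _).trans_lt (max_lt ?_ ?_)
    · rw [norm_mul]; nlinarith [norm_nonneg (n : E), norm_nonneg (a : E)]
    · rw [norm_mul]; nlinarith [norm_nonneg (p : E), norm_nonneg (b : E)]
  rw [h1, norm_one] at h2
  exact lt_irrefl _ h2

theorem not_dvd_choose_pow_mul {p : ℕ} (hp : p.Prime) (k : ℕ) {m : ℕ} (hm : ¬ p ∣ m) :
    ¬ p ∣ (p ^ k * m).choose (p ^ k) := by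
  have := Fact.mk hp
  have key : (p ^ k * m).choose (p ^ k) ≡ m [MOD p] := by
    induction k with
    | zero => simp [Nat.ModEq.refl]
    | succ k ih =>
      have h := Choose.choose_modEq_choose_mod_mul_choose_div_nat (p := p)
        (n := p ^ (k + 1) * m) (k := p ^ (k + 1))
      have e1 : p ^ (k + 1) * m = p * (p ^ k * m) := by ring
      have e2 : p ^ (k + 1) = p * p ^ k := by ring
      rw [e1, e2, Nat.mul_mod_right, Nat.mul_mod_right, Nat.mul_div_cancel_left _ hp.pos,
        Nat.mul_div_cancel_left _ hp.pos, Nat.choose_self, one_mul] at h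
      rw [e1, e2]
      exact h.trans ih
  rwa [key.dvd_iff dvd_rfl]

theorem choose_prime_pow_succ {p : ℕ} (hp : p.Prime) (k : ℕ) :
    ∃ m, (p ^ (k + 1)).choose (p ^ k) = p * m ∧ ¬ p ∣ m := by
  have hle : p ^ k ≤ p ^ (k + 1) := Nat.pow_le_pow_right hp.pos k.le_succ
  have h := Nat.factorization_choose_prime_pow hp hle (pow_ne_zero k hp.ne_zero)
  rw [hp.factorization_pow, Finsupp.single_eq_same, Nat.add_sub_cancel_left] at h
  have hne : (p ^ (k + 1)).choose (p ^ k) ≠ 0 := (Nat.choose_pos hle).ne'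
  refine ⟨ordCompl[p] ((p ^ (k + 1)).choose (p ^ k)), ?_, Nat.not_dvd_ordCompl hp hne⟩
  conv_lhs => rw [← Nat.ordProj_mul_ordCompl_eq_self ((p ^ (k + 1)).choose (p ^ k)) p]
  rw [h, pow_one]

theorem norm_coeff_prod_X_sub_C_le {E : Type*} [NormedField E] [IsUltrametricDist E] {r : ℝ}
    (hr : 0 ≤ r) (s : Multiset E) (hs : ∀ a ∈ s, ‖a‖ ≤ r) (i : ℕ) (hi : i ≤ s.card) :
    ‖((s.map fun a => X - C a).prod).coeff i‖ ≤ r ^ (s.card - i) := by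
  induction s using Multiset.induction_on generalizing i with
  | empty =>
    obtain rfl : i = 0 := by simpa using hi
    simp
  | cons a s ih =>
    have hs' : ∀ b ∈ s, ‖b‖ ≤ r := fun b hb => hs b (Multiset.mem_cons_of_mem hb)
    have ha : ‖a‖ ≤ r := hs a (Multiset.mem_cons_self a s)
    have hdeg : ((s.map fun a => X - C a).prod).natDegree = s.card :=
      natDegree_multiset_prod_X_sub_C_eq_card s
    have hsecond : ∀ j ≤ s.card + 1, ‖a * ((s.map fun a => X - C a).prod).coeff j‖
        ≤ r ^ (s.card + 1 - j) := by
      intro j hj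
      rcases hj.lt_or_eq with h | h
      · rw [norm_mul, show s.card + 1 - j = (s.card - j) + 1 by omega, pow_succ, mul_comm]
        exact mul_le_mul (ih hs' j (by omega)) ha (norm_nonneg _) (by positivity)
      · rw [coeff_eq_zero_of_natDegree_lt (by omega), mul_zero, norm_zero]; positivity
    rw [Multiset.map_cons, Multiset.prod_cons, Multiset.card_cons, sub_mul, coeff_sub, coeff_C_mul]
    rw [Multiset.card_cons] at hi
    rw [sub_eq_add_neg]
    refine (IsUltrametricDist.norm_add_le_max _ _).trans
      (max_le ?_ ((norm_neg _).trans_le (hsecond i hi)))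
    cases i with
    | zero => rw [coeff_X_mul_zero, norm_zero]; positivity
    | succ j =>
      rw [coeff_X_mul, Nat.add_sub_add_right]
      exact ih hs' j (by omega)

variable {L E : Type*} [Field L] [NormedField E] [IsUltrametricDist E] [Algebra L E]
  [IsAlgClosed E] [Algebra.IsAlgebraic L E] [CharZero L]

/-- If all conjugates of `α` are within `r` of `α`, a divided derivative of the minimal polynomial
of `α` has a root near `α`. -/
theorem exists_near_root_hasseDeriv {α : E} {r : ℝ} (hr : 0 ≤ r)
    (hα : ∀ g : E ≃ₐ[L] E, ‖g α - α‖ ≤ r) {q : ℕ} (hq : q < (minpoly L α).natDegree) :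
    ∃ β : E, (minpoly L β).natDegree ≤ (minpoly L α).natDegree - q ∧
      ‖(((minpoly L α).natDegree.choose q : ℕ) : E)‖ *
        ‖α - β‖ ^ ((minpoly L α).natDegree - q) ≤ r ^ ((minpoly L α).natDegree - q) := by
  have : CharZero E := charZero_of_injective_algebraMap (algebraMap L E).injective
  have : Normal L E := normal_iff.2 fun x =>
    ⟨Algebra.IsIntegral.isIntegral x, IsAlgClosed.splits _⟩
  set P := minpoly L α with hP
  set n := P.natDegree with hn
  have hint : IsIntegral L α := Algebra.IsIntegral.isIntegral α
  have hmonic : P.Monic := minpoly.monic hint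
  set D := hasseDeriv q P with hD
  have hDdeg : D.natDegree = n - q := natDegree_hasseDeriv P q
  have hDlead : D.leadingCoeff = (n.choose q : L) := by
    rw [leadingCoeff, hDdeg, hD, hasseDeriv_coeff, Nat.sub_add_cancel hq.le, hmonic.coeff_natDegree,
      mul_one]
  have hchoose : (n.choose q : L) ≠ 0 := by exact_mod_cast (Nat.choose_pos hq.le).ne'
  have hD0 : D ≠ 0 := by rw [← leadingCoeff_ne_zero, hDlead]; exact hchoose
  set PE := P.map (algebraMap L E) with hPE
  set DE := D.map (algebraMap L E) with hDE
  have hDE' : DE = hasseDeriv q PE := by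
    ext i; simp [hDE, hD, hPE, hasseDeriv_coeff]
  -- the value at `α` is small
  have hval : ‖DE.eval α‖ ≤ r ^ (n - q) := by
    rw [hDE', ← taylor_coeff]
    have hsplit : PE = (PE.roots.map fun a => X - C a).prod :=
      (IsAlgClosed.splits PE).eq_prod_roots_of_monic (hmonic.map _)
    have hcard : PE.roots.card = n := by
      rw [← (IsAlgClosed.splits PE).natDegree_eq_card_roots, hPE, natDegree_map]
    -- Recentred at α, the polynomial has roots a - α with a conjugate to α, all of norm at most r,
    -- so its coefficients obey the symmetric function bound.
    have ht : taylor α PE = ((PE.roots.map fun a => a - α).map fun a => X - C a).prod := by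
      conv_lhs => rw [hsplit]
      rw [taylor_apply, multiset_prod_comp, Multiset.map_map, Multiset.map_map]
      congr 1
      refine Multiset.map_congr rfl fun a _ => ?_
      simp only [Function.comp, sub_comp, X_comp, C_comp, map_sub]
      ring
    rw [ht]
    refine (norm_coeff_prod_X_sub_C_le hr _ ?_ q ?_).trans_eq ?_
    · intro b hb
      obtain ⟨a, ha, rfl⟩ := Multiset.mem_map.1 hb
      have haroot : aeval a P = 0 := by
        have := (mem_roots'.1 ha).2
        rwa [IsRoot.def, hPE, eval_map_algebraMap] at this
      obtain ⟨σ, hσ⟩ := minpoly.exists_algEquiv_of_root' hint.isAlgebraic haroot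
      rw [← hσ]
      exact hα σ
    · rw [Multiset.card_map, hcard]; exact hq.le
    · rw [Multiset.card_map, hcard]
  have hsplitD : DE = C DE.leadingCoeff * (DE.roots.map fun a => X - C a).prod :=
    (IsAlgClosed.splits DE).eq_prod_roots
  have hcardD : DE.roots.card = n - q := by
    rw [← (IsAlgClosed.splits DE).natDegree_eq_card_roots, hDE, natDegree_map, hDdeg]
  have hlead : DE.leadingCoeff = ((n.choose q : ℕ) : E) := by
    rw [hDE, leadingCoeff_map, hDlead, map_natCast]
  have heval : ‖DE.eval α‖ = ‖((n.choose q : ℕ) : E)‖ * (DE.roots.map fun a => ‖α - a‖).prod := by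
    conv_lhs => rw [hsplitD]
    rw [eval_mul, eval_C, hlead, norm_mul, eval_multiset_prod]
    congr 1
    change (normHom : E →*₀ ℝ) _ = _
    rw [map_multiset_prod, Multiset.map_map, Multiset.map_map]
    simp [Function.comp_def]
  have hne : DE.roots ≠ 0 := by
    rw [← Multiset.card_pos, hcardD]; omega
  -- The root nearest to α makes every factor of the product at least ‖α - β‖.
  obtain ⟨β, hβ, hmin⟩ : ∃ β ∈ DE.roots, ∀ b ∈ DE.roots, ‖α - β‖ ≤ ‖α - b‖ := by
    classical
    obtain ⟨b0, hb0⟩ := Multiset.exists_mem_of_ne_zero hne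
    obtain ⟨β, hβ, h⟩ := DE.roots.toFinset.exists_min_image (fun b => ‖α - b‖)
      ⟨b0, Multiset.mem_toFinset.2 hb0⟩
    exact ⟨β, Multiset.mem_toFinset.1 hβ, fun b hb => h b (Multiset.mem_toFinset.2 hb)⟩
  refine ⟨β, ?_, ?_⟩
  · rw [← hDdeg]
    refine natDegree_le_of_dvd (minpoly.dvd L β ?_) hD0
    have := (mem_roots'.1 hβ).2
    rwa [IsRoot.def, hDE, eval_map_algebraMap] at this
  · refine le_trans ?_ hval
    rw [heval]
    refine mul_le_mul_of_nonneg_left ?_ (norm_nonneg _)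
    have := Multiset.prod_map_le_prod_map₀ (s := DE.roots) (fun _ => ‖α - β‖) (fun a => ‖α - a‖)
      (fun _ _ => norm_nonneg _) hmin
    rwa [Multiset.map_const', Multiset.prod_replicate, hcardD] at this

/-- An element whose conjugates over `L` are all within `r` of it is within `p ^ 2 * r` of an
element of `L`. -/
theorem exists_approx_of_conjugates_near {p : ℕ} (hp : p.Prime) (hpE : ‖(p : E)‖ = (p : ℝ)⁻¹)
    (hiso : ∀ (g : E ≃ₐ[L] E) (x : E), ‖g x‖ = ‖x‖) {α : E} {r : ℝ}
    (hα : ∀ g : E ≃ₐ[L] E, ‖g α - α‖ ≤ r) :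
    ∃ a : L, ‖α - algebraMap L E a‖ ≤ (p : ℝ) ^ 2 * r := by
  have hp1 : (1 : ℝ) < p := by exact_mod_cast hp.one_lt
  have hp0 : (0 : ℝ) < p := by positivity
  have hr : 0 ≤ r := (norm_nonneg _).trans (hα 1)
  -- s k is the sum of (1/2)^i over i < k. The descent loses a factor p^((1/2)^i) only at degree
  -- p^(i+1), where the binomial coefficient has valuation 1; the total exponent stays below 2.
  set s : ℕ → ℝ := fun k => 2 - 2 * (1 / 2 : ℝ) ^ k with hs
  have hs_mono : Monotone s := fun a b hab => by
    have := pow_le_pow_of_le_one (by norm_num : (0 : ℝ) ≤ 1 / 2) (by norm_num) hab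
    simp only [hs]; linarith
  have hs_nonneg : ∀ k, 0 ≤ s k := fun k => by
    have := hs_mono (Nat.zero_le k); simpa [hs] using this
  have hpE1 : ‖(p : E)‖ < 1 := by rw [hpE]; exact inv_lt_one_of_one_lt₀ hp1
  suffices H : ∀ n : ℕ, ∀ (α : E) (r : ℝ), (∀ g : E ≃ₐ[L] E, ‖g α - α‖ ≤ r) →
      (minpoly L α).natDegree = n →
      ∃ a : L, ‖α - algebraMap L E a‖ ≤ (p : ℝ) ^ (s (Nat.log p n)) * r by
    obtain ⟨a, ha⟩ := H _ α r hα rfl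
    refine ⟨a, ha.trans (mul_le_mul_of_nonneg_right ?_ hr)⟩
    rw [← Real.rpow_natCast]
    refine Real.rpow_le_rpow_of_exponent_le hp1.le ?_
    have : (0 : ℝ) ≤ (1 / 2 : ℝ) ^ (Nat.log p (minpoly L α).natDegree) := by positivity
    simp only [hs]; push_cast; linarith
  clear hα hr r α
  intro n
  induction n using Nat.strong_induction_on with
  | _ n ih =>
  intro α r hα hn
  have hr : 0 ≤ r := (norm_nonneg _).trans (hα 1)
  -- one step of the descent
  have step : ∀ (q : ℕ) (t : ℝ) (e : ℝ), 0 < q → q < n → r ≤ t →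
      (∀ β : E, ‖((n.choose q : ℕ) : E)‖ * ‖α - β‖ ^ (n - q) ≤ r ^ (n - q) → ‖α - β‖ ≤ t) →
      (∀ j, j ≤ n - q → (p : ℝ) ^ s (Nat.log p j) * t ≤ e) →
      ∃ a : L, ‖α - algebraMap L E a‖ ≤ e := by
    intro q t e hq0 hqn hrt hnear hbound
    obtain ⟨β, hβdeg, hβ⟩ := exists_near_root_hasseDeriv hr hα (hn ▸ hqn)
    rw [hn] at hβ hβdeg
    have hαβ := hnear β hβ
    have hconj : ∀ g : E ≃ₐ[L] E, ‖g β - β‖ ≤ t := fun g => by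
      have e1 : g β - β = g (β - α) + ((g α - α) + (α - β)) := by rw [map_sub]; ring
      rw [e1]
      refine (IsUltrametricDist.norm_add_le_max _ _).trans (max_le ?_ ?_)
      · rwa [hiso, norm_sub_rev]
      · exact (IsUltrametricDist.norm_add_le_max _ _).trans (max_le ((hα g).trans hrt) hαβ)
    obtain ⟨a, ha⟩ := ih _ (by omega) β t hconj rfl
    have h1 := hbound _ hβdeg
    refine ⟨a, ?_⟩
    rw [show α - algebraMap L E a = (α - β) + (β - algebraMap L E a) by ring]
    refine (IsUltrametricDist.norm_add_le_max _ _).trans (max_le (hαβ.trans ?_) (ha.trans h1))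
    refine le_trans ?_ h1
    exact le_mul_of_one_le_left (hr.trans hrt) (Real.one_le_rpow hp1.le (hs_nonneg _))
  have hn0 : 0 < n := hn ▸ minpoly.natDegree_pos (Algebra.IsIntegral.isIntegral α)
  -- The derivative of order p^k is used, p^k being the exact power of p in n. Its binomial
  -- coefficient is a unit unless n is a power of p.
  obtain ⟨k, m, hm, hnk⟩ := Nat.exists_eq_pow_mul_and_not_dvd hn0.ne' p hp.ne_one
  by_cases hm1 : m = 1
  · cases k with
    | zero =>
      have : (minpoly L α).degree = 1 := by
        rw [degree_eq_natDegree (minpoly.ne_zero (Algebra.IsIntegral.isIntegral α)), hn, hnk, hm1]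
        simp
      obtain ⟨a, rfl⟩ := minpoly.mem_range_of_degree_eq_one L α this
      exact ⟨a, by rw [sub_self, norm_zero]; positivity⟩
    | succ k =>
      rw [hm1, mul_one] at hnk
      have hpk : 0 < p ^ k := pow_pos hp.pos k
      have hsub : n - p ^ k = p ^ k * (p - 1) := by
        rw [hnk, pow_succ, Nat.mul_sub, mul_one]
      have hN : 2 ^ k ≤ n - p ^ k := by
        rw [hsub]
        calc 2 ^ k ≤ p ^ k := Nat.pow_le_pow_left hp.two_le k
          _ ≤ p ^ k * (p - 1) := Nat.le_mul_of_pos_right _ (by have := hp.two_le; omega)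
      have hlt : p ^ k < n := by have := Nat.two_pow_pos k; omega
      refine step (p ^ k) ((p : ℝ) ^ ((1 / 2 : ℝ) ^ k) * r) _ hpk hlt ?_ ?_ ?_
      · exact le_mul_of_one_le_left hr (Real.one_le_rpow hp1.le (by positivity))
      -- Here ‖α - β‖^(n - p^k) ≤ p * r^(n - p^k), and n - p^k ≥ 2^k bounds the root of p by
      -- p^((1/2)^k).
      · intro β hβ
        obtain ⟨m', hm', hpm'⟩ := choose_prime_pow_succ hp k
        rw [hnk, hm', Nat.cast_mul, norm_mul, hpE, norm_natCast_eq_one_of_not_dvd hp hpE1 hpm',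
          mul_one, ← hnk, inv_mul_le_iff₀ hp0] at hβ
        refine le_of_pow_le_pow_left₀ (n := n - p ^ k) (by omega) (by positivity) (hβ.trans ?_)
        rw [mul_pow]
        refine mul_le_mul_of_nonneg_right ?_ (by positivity)
        rw [← Real.rpow_natCast, ← Real.rpow_mul hp0.le]
        conv_lhs => rw [← Real.rpow_one (p : ℝ)]
        refine Real.rpow_le_rpow_of_exponent_le hp1.le ?_
        have h2 : (2 : ℝ) ^ k ≤ ((n - p ^ k : ℕ) : ℝ) := by exact_mod_cast hN
        calc (1 : ℝ) = (1 / 2) ^ k * 2 ^ k := by rw [← mul_pow]; norm_num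
          _ ≤ _ := mul_le_mul_of_nonneg_left h2 (by positivity)
      · intro j hj
        have hlogj : Nat.log p j ≤ k := by
          refine Nat.lt_succ_iff.1 (Nat.log_lt_of_lt_pow' (by omega) ?_)
          rw [Nat.succ_eq_add_one, ← hnk]; omega
        rw [← mul_assoc, ← Real.rpow_add hp0, hnk, Nat.log_pow hp.one_lt]
        refine mul_le_mul_of_nonneg_right (Real.rpow_le_rpow_of_exponent_le hp1.le ?_) hr
        have := hs_mono hlogj
        have e2 : s (k + 1) = s k + (1 / 2 : ℝ) ^ k := by simp only [hs, pow_succ]; ring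
        rw [e2]; linarith
  · have hm2 : 1 < m := by
      rcases Nat.eq_zero_or_pos m with h | h
      · exact absurd (h ▸ dvd_zero p) hm
      · omega
    have hpk : 0 < p ^ k := pow_pos hp.pos k
    have hlt : p ^ k < n := by rw [hnk]; exact lt_mul_of_one_lt_right hpk hm2
    refine step (p ^ k) r _ hpk hlt le_rfl ?_ ?_
    · intro β hβ
      rw [hnk, norm_natCast_eq_one_of_not_dvd hp hpE1 (not_dvd_choose_pow_mul hp k hm), one_mul,
        ← hnk] at hβ
      exact le_of_pow_le_pow_left₀ (by omega) hr hβ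
    · intro j hj
      refine mul_le_mul_of_nonneg_right (Real.rpow_le_rpow_of_exponent_le hp1.le (hs_mono ?_)) hr
      exact Nat.log_mono_right (by omega)

end Ax

/-! ### Orthogonality of the powers of a uniformiser. -/

noncomputable section

section Orthogonality

open Polynomial

variable {L A : Type*} [Field L] [NormedField A] [IsUltrametricDist A] [Algebra L A]

/-- If the values of `L` are powers of `‖π‖ ^ N`, the powers `π ^ i` with `i < N` are
orthogonal over `L`. -/
theorem exists_norm_aeval_eq {π : A} (hπ0 : 0 < ‖π‖) (hπ1 : ‖π‖ < 1) {N : ℕ}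
    (hL : ∀ b : L, b ≠ 0 → ∃ i : ℤ, ‖algebraMap L A b‖ = ‖π‖ ^ ((N : ℤ) * i))
    {P : L[X]} (hP : P.natDegree < N) (hP0 : P ≠ 0) :
    ∃ j : ℕ, P.coeff j ≠ 0 ∧ ‖aeval π P‖ = ‖algebraMap L A (P.coeff j)‖ * ‖π‖ ^ j ∧
      ∀ i, ‖algebraMap L A (P.coeff i)‖ * ‖π‖ ^ i ≤ ‖aeval π P‖ := by
  set f : ℕ → A := fun i => algebraMap L A (P.coeff i) * π ^ i with hf
  have hnf : ∀ i, ‖f i‖ = ‖algebraMap L A (P.coeff i)‖ * ‖π‖ ^ i := fun i => by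
    rw [hf, norm_mul, norm_pow]
  have hsum : aeval π P = ∑ i ∈ P.support, f i := by
    rw [aeval_def, eval₂_eq_sum, Polynomial.sum]
  -- The norm of the i-th term is a power of ‖π‖ with exponent congruent to i mod N, so distinct
  -- terms have distinct norms and the largest one dominates.
  have hinj : ∀ i ∈ P.support, ∀ j ∈ P.support, ‖f i‖ = ‖f j‖ → i = j := by
    intro i hi j hj hij
    obtain ⟨a, ha⟩ := hL _ (mem_support_iff.1 hi)
    obtain ⟨b, hb⟩ := hL _ (mem_support_iff.1 hj)
    have hiN := (le_natDegree_of_mem_supp i hi).trans_lt hP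
    have hjN := (le_natDegree_of_mem_supp j hj).trans_lt hP
    rw [hnf, hnf, ha, hb, ← zpow_natCast, ← zpow_natCast, ← zpow_add₀ hπ0.ne',
      ← zpow_add₀ hπ0.ne'] at hij
    have h := zpow_right_injective₀ hπ0 hπ1.ne hij
    have hmod := congrArg (· % (N : ℤ)) h
    simp only [Int.mul_add_emod_self_left] at hmod
    rw [Int.emod_eq_of_lt (by omega) (by omega), Int.emod_eq_of_lt (by omega) (by omega)] at hmod
    exact_mod_cast hmod
  obtain ⟨j, hj, hmax⟩ := P.support.exists_max_image (fun i => ‖f i‖) (nonempty_support_iff.2 hP0)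
  have hval : ‖aeval π P‖ = ‖f j‖ := by
    rw [hsum]
    refine IsNonarchimedean.apply_sum_eq_of_lt (f := fun x : A => ‖x‖)
      (fun x y => IsUltrametricDist.norm_add_le_max x y) (fun x => (norm_neg x).symm) hj ?_
    intro i hi hij
    exact lt_of_le_of_ne (hmax i hi) fun h => hij (hinj i hi j hj h)
  refine ⟨j, mem_support_iff.1 hj, hval.trans (hnf j), fun i => ?_⟩
  rw [← hnf, hval]
  by_cases hi : i ∈ P.support
  · exact hmax i hi
  · rw [hnf, notMem_support_iff.1 hi, map_zero, norm_zero, zero_mul]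
    exact norm_nonneg _

theorem eq_zero_of_aeval_eq_zero_of_orthogonal {π : A} (hπ0 : 0 < ‖π‖) (hπ1 : ‖π‖ < 1) {N : ℕ}
    (hL : ∀ b : L, b ≠ 0 → ∃ i : ℤ, ‖algebraMap L A b‖ = ‖π‖ ^ ((N : ℤ) * i))
    {P : L[X]} (hP : P.natDegree < N) (h : aeval π P = 0) : P = 0 := by
  by_contra hP0
  obtain ⟨j, hj, hval, -⟩ := exists_norm_aeval_eq hπ0 hπ1 hL hP hP0
  rw [h, norm_zero, eq_comm, mul_eq_zero] at hval
  rcases hval with h | h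
  · exact hj ((map_eq_zero _).1 (norm_eq_zero.1 h))
  · exact (pow_pos hπ0 j).ne' h

theorem exists_norm_aeval_eq_zpow {π : A} (hπ0 : 0 < ‖π‖) (hπ1 : ‖π‖ < 1) {N : ℕ}
    (hL : ∀ b : L, b ≠ 0 → ∃ i : ℤ, ‖algebraMap L A b‖ = ‖π‖ ^ ((N : ℤ) * i))
    {P : L[X]} (hP : P.natDegree < N) (hP0 : P ≠ 0) : ∃ i : ℤ, ‖aeval π P‖ = ‖π‖ ^ i := by
  obtain ⟨j, hj, hval, -⟩ := exists_norm_aeval_eq hπ0 hπ1 hL hP hP0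
  obtain ⟨a, ha⟩ := hL _ hj
  exact ⟨N * a + j, by rw [hval, ha, zpow_add₀ hπ0.ne', zpow_natCast]⟩

theorem aeval_taylor_one {L A : Type*} [Field L] [Field A] [Algebra L A] (P : L[X]) (x : A) : aeval x (taylor 1 P) = aeval (x + 1) P := by
  rw [taylor_apply, aeval_comp]
  simp

/-- The powers of ζ - 1 are orthogonal, whereas those of ζ all have norm 1. So P is rewritten in
powers of X - 1; its value at 0 is the alternating sum of the new coefficients, each controlled by
orthogonality. -/
theorem norm_coeff_zero_le {ζ : A} (hπ0 : 0 < ‖ζ - 1‖) (hπ1 : ‖ζ - 1‖ < 1) {N : ℕ}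
    (hL : ∀ b : L, b ≠ 0 → ∃ i : ℤ, ‖algebraMap L A b‖ = ‖ζ - 1‖ ^ ((N : ℤ) * i))
    {P : L[X]} (hP : P.natDegree < N) :
    ‖ζ - 1‖ ^ N * ‖algebraMap L A (P.coeff 0)‖ ≤ ‖aeval ζ P‖ := by
  by_cases hP0 : P = 0
  · simp [hP0]
  have hQ0 : taylor 1 P ≠ 0 := by rwa [Ne, taylor_eq_zero]
  have hQ : (taylor 1 P).natDegree < N := by rwa [natDegree_taylor]
  obtain ⟨-, -, -, hle⟩ := exists_norm_aeval_eq hπ0 hπ1 hL hQ hQ0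
  rw [aeval_taylor_one, sub_add_cancel] at hle
  have hcoeff : algebraMap L A (P.coeff 0)
      = ∑ i ∈ Finset.range N, algebraMap L A ((taylor 1 P).coeff i) * (-1) ^ i := by
    have h1 : P.coeff 0 = (taylor 1 P).eval (-1) := by
      rw [taylor_eval, neg_add_cancel, coeff_zero_eq_eval_zero]
    rw [h1, eval_eq_sum_range' hQ, map_sum]
    simp
  rw [hcoeff, mul_comm, ← le_div_iff₀ (by positivity)]
  refine IsUltrametricDist.norm_sum_le_of_forall_le_of_nonneg (by positivity) fun i hi => ?_
  rw [norm_mul, norm_pow, norm_neg, norm_one, one_pow, mul_one, le_div_iff₀ (by positivity)]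
  refine le_trans (mul_le_mul_of_nonneg_left ?_ (norm_nonneg _)) (hle i)
  exact pow_le_pow_of_le_one hπ0.le hπ1.le (Finset.mem_range.1 hi).le

end Orthogonality

/-! ### Constant terms modulo X^q - ω. -/

section PolynomialReduction

open Polynomial

variable {L : Type*} [Field L]

theorem X_pow_modByMonic_X_pow_sub_C {q : ℕ} (hq : 0 < q) (ω : L) (i : ℕ) :
    (X ^ i : L[X]) %ₘ (X ^ q - C ω) = C (ω ^ (i / q)) * X ^ (i % q) := by
  have hM : (X ^ q - C ω : L[X]).Monic := monic_X_pow_sub_C ω hq.ne'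
  have hdeg : (C (ω ^ (i / q)) * X ^ (i % q) : L[X]).degree < (X ^ q - C ω : L[X]).degree := by
    rw [degree_X_pow_sub_C hq]
    refine (degree_C_mul_X_pow_le _ _).trans_lt ?_
    exact_mod_cast Nat.mod_lt i hq
  rw [← (modByMonic_eq_self_iff hM).2 hdeg]
  refine modByMonic_eq_of_dvd_sub hM ?_
  have h : (X ^ i : L[X]) - C (ω ^ (i / q)) * X ^ (i % q)
      = ((X ^ q) ^ (i / q) - (C ω) ^ (i / q)) * X ^ (i % q) := by
    rw [sub_mul, ← pow_mul, ← pow_add, Nat.div_add_mod, C_pow]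
  rw [h]
  exact (sub_dvd_pow_sub_pow _ _ _).mul_right _

theorem coeff_zero_modByMonic_X_pow_sub_C {q : ℕ} (hq : 0 < q) (ω : L) (A : L[X])
    (hA : ∀ i, q ∣ i → i ≠ 0 → A.coeff i = 0) :
    (A %ₘ (X ^ q - C ω)).coeff 0 = A.coeff 0 := by
  have hlin : A %ₘ (X ^ q - C ω)
      = ∑ i ∈ Finset.range (A.natDegree + 1), A.coeff i • ((X ^ i : L[X]) %ₘ (X ^ q - C ω)) := by
    conv_lhs => rw [A.as_sum_range_C_mul_X_pow]
    change modByMonicHom _ _ = _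
    rw [map_sum]
    refine Finset.sum_congr rfl fun i _ => ?_
    rw [← smul_eq_C_mul, map_smul]
    rfl
  rw [hlin, finsetSum_coeff, Finset.sum_eq_single 0]
  · rw [coeff_smul, X_pow_modByMonic_X_pow_sub_C hq]
    simp
  · intro i _ hi0
    rw [coeff_smul, X_pow_modByMonic_X_pow_sub_C hq, coeff_C_mul, coeff_X_pow]
    by_cases hi : q ∣ i
    · rw [hA i hi hi0, zero_smul]
    · rw [if_neg, mul_zero, smul_zero]
      exact fun h => hi (Nat.dvd_of_mod_eq_zero h.symm)
  · intro h
    exact absurd (Finset.mem_range.2 (Nat.succ_pos _)) h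

/-- Multiplication by e, coprime to q, sends no nonzero exponent below q to a multiple of q, so
nothing new reaches the constant term. This is the Galois invariance of the normalised trace. -/
theorem coeff_zero_expand_modByMonic {q : ℕ} (hq : 0 < q) (ω : L) {P : L[X]}
    (hP : P.natDegree < q) {e : ℕ} (he : e.Coprime q) (he0 : 0 < e) :
    (expand L e P %ₘ (X ^ q - C ω)).coeff 0 = P.coeff 0 := by
  rw [coeff_zero_modByMonic_X_pow_sub_C hq, coeff_expand he0, if_pos (dvd_zero e), Nat.zero_div]
  intro i hi hi0
  rw [coeff_expand he0]
  split_ifs with hei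
  · obtain ⟨j, rfl⟩ := hei
    rw [Nat.mul_div_cancel_left _ he0]
    have hj : q ∣ j := he.symm.dvd_of_dvd_mul_left hi
    have hj0 : j ≠ 0 := fun h => hi0 (by rw [h, mul_zero])
    exact coeff_eq_zero_of_natDegree_lt (hP.trans_le (Nat.le_of_dvd (Nat.pos_of_ne_zero hj0) hj))
  · rfl

theorem natDegree_modByMonic_X_pow_sub_C_lt {q : ℕ} (hq : 0 < q) (ω : L) (Q : L[X]) :
    (Q %ₘ (X ^ q - C ω)).natDegree < q := by
  have hM : (X ^ q - C ω : L[X]).Monic := monic_X_pow_sub_C ω hq.ne'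
  have h := natDegree_modByMonic_lt Q hM fun h => by
    have := congrArg natDegree h
    rw [natDegree_X_pow_sub_C, natDegree_one] at this
    omega
  rwa [natDegree_X_pow_sub_C] at h

theorem aeval_modByMonic_X_pow_sub_C {A : Type*} [Field A] [Algebra L A] {q : ℕ} {ω : L} {ζ : A}
    (hζ : ζ ^ q = algebraMap L A ω) (Q : L[X]) :
    aeval ζ (Q %ₘ (X ^ q - C ω)) = aeval ζ Q := by
  conv_rhs => rw [← modByMonic_add_div Q (X ^ q - C ω)]
  simp [hζ]

end PolynomialReduction

/-! ### Norms on F and its algebraic closure. -/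

namespace PadicHodge

variable (p : ℕ) [Fact p.Prime] (k : Type*) [Field k] [CharP k p] [PerfectRing k p]

instance : IsUltrametricDist (Fbar p k) :=
  IsUltrametricDist.isUltrametricDist_of_forall_norm_add_le_max_norm
    (isNonarchimedean_spectralNorm (K := F p k) (L := Fbar p k))

theorem norm_algebraMap_Fbar (x : F p k) : ‖algebraMap (F p k) (Fbar p k) x‖ = ‖x‖ :=
  spectralNorm_extends x

theorem norm_p_Fbar : ‖(p : Fbar p k)‖ = (p : ℝ)⁻¹ := by
  rw [← map_natCast (algebraMap (F p k) (Fbar p k)), norm_algebraMap_Fbar, norm_p]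

theorem norm_galois_base (g : Gal(Fbar p k/F p k)) (x : Fbar p k) : ‖g x‖ = ‖x‖ :=
  (spectralNorm_eq_of_equiv g x).symm

theorem exists_norm_eq_zpow (x : F p k) (hx : x ≠ 0) : ∃ i : ℤ, ‖x‖ = ((p : ℝ)⁻¹) ^ i := by
  have hv : (IsDiscreteValuationRing.maximalIdeal (WittVector p k)).valuation (F p k) x ≠ 0 :=
    (Valuation.ne_zero_iff _).2 hx
  refine ⟨-(Multiplicative.toAdd (WithZero.unzero hv)), ?_⟩
  have h := WithZeroMulInt.toNNReal_neg_apply (one_lt_p p).ne_zero hv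
  have h2 : ‖x‖ = ((WithZeroMulInt.toNNReal (one_lt_p p).ne_zero
    ((IsDiscreteValuationRing.maximalIdeal (WittVector p k)).valuation (F p k) x) : NNReal) : ℝ) :=
    rfl
  rw [h2, h, NNReal.coe_zpow, NNReal.coe_natCast, inv_zpow, zpow_neg, inv_inv]

instance : CharZero (F p k) := by
  have hp : p.Prime := Fact.out
  have hlt : ‖(p : F p k)‖ < 1 := by
    rw [norm_p]
    exact inv_lt_one_of_one_lt₀ (by exact_mod_cast hp.one_lt)
  refine charZero_of_inj_zero fun n hn => ?_
  by_contra hn0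
  obtain ⟨i, m, hm, rfl⟩ := Nat.exists_eq_pow_mul_and_not_dvd hn0 p hp.ne_one
  have h := congrArg norm hn
  rw [Nat.cast_mul, Nat.cast_pow, norm_mul, norm_pow, norm_p, norm_zero,
    norm_natCast_eq_one_of_not_dvd hp hlt hm, mul_one] at h
  have : (0 : ℝ) < (p : ℝ)⁻¹ := inv_pos.2 (by exact_mod_cast hp.pos)
  exact (pow_pos this i).ne' h

end PadicHodge
end

/-! ### The cyclotomic tower over F and its normalised traces. -/

noncomputable section
namespace PadicHodge

section Cyclotomic

open Polynomial IntermediateField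

variable {p : ℕ} [Fact p.Prime] {k : Type*} [Field k] [CharP k p] [PerfectRing k p]

variable (p k) in
theorem exists_isPrimitiveRoot (n : ℕ) : ∃ ζ : Fbar p k, IsPrimitiveRoot ζ (p ^ n) := by
  have : NeZero (p ^ n) := ⟨pow_ne_zero n (Fact.out : p.Prime).ne_zero⟩
  exact HasEnoughRootsOfUnity.exists_primitiveRoot (Fbar p k) (p ^ n)

theorem norm_eq_one_of_pow_eq_one {ζ : Fbar p k} {n : ℕ} (hn : n ≠ 0) (h : ζ ^ n = 1) :
    ‖ζ‖ = 1 := by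
  have := congrArg norm h
  rw [norm_pow, norm_one] at this
  exact (pow_eq_one_iff_of_nonneg (norm_nonneg _) hn).1 this

theorem norm_pow_sub_one_le {ζ : Fbar p k} (hζ : ‖ζ‖ = 1) (i : ℕ) : ‖ζ ^ i - 1‖ ≤ ‖ζ - 1‖ := by
  rw [← geom_sum_mul, norm_mul]
  refine mul_le_of_le_one_left (norm_nonneg _) ?_
  refine IsUltrametricDist.norm_sum_le_of_forall_le_of_nonneg zero_le_one fun j _ => ?_
  rw [norm_pow, hζ, one_pow]

/-- Any two primitive roots are powers of each other, so all the factors 1 - μ have the same norm;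
their product is the value p of the cyclotomic polynomial at 1. -/
theorem norm_sub_one_pow_totient {n : ℕ} (hn : 1 ≤ n) {ζ : Fbar p k}
    (hζ : IsPrimitiveRoot ζ (p ^ n)) : ‖ζ - 1‖ ^ (p ^ n).totient = (p : ℝ)⁻¹ := by
  have hp : p.Prime := Fact.out
  have hpn : p ^ n ≠ 0 := pow_ne_zero n hp.ne_zero
  have : NeZero (p ^ n) := ⟨hpn⟩
  have hnorm : ∀ μ ∈ primitiveRoots (p ^ n) (Fbar p k), ‖1 - μ‖ = ‖ζ - 1‖ := by
    intro μ hμ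
    have hμ' := (mem_primitiveRoots (Nat.pos_of_ne_zero hpn)).1 hμ
    rw [norm_sub_rev]
    refine le_antisymm ?_ ?_
    · obtain ⟨i, -, rfl⟩ := hζ.eq_pow_of_pow_eq_one hμ'.pow_eq_one
      exact norm_pow_sub_one_le (norm_eq_one_of_pow_eq_one hpn hζ.pow_eq_one) i
    · obtain ⟨i, -, rfl⟩ := hμ'.eq_pow_of_pow_eq_one hζ.pow_eq_one
      exact norm_pow_sub_one_le (norm_eq_one_of_pow_eq_one hpn hμ'.pow_eq_one) i
  have heval : ((cyclotomic (p ^ n) (Fbar p k)).eval 1) = p := by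
    obtain ⟨j, rfl⟩ : ∃ j, n = j + 1 := ⟨n - 1, by omega⟩
    exact eval_one_cyclotomic_prime_pow j
  rw [cyclotomic_eq_prod_X_sub_primitiveRoots hζ, eval_prod] at heval
  have h := congrArg norm heval
  rw [norm_prod, norm_p_Fbar] at h
  rw [← h, ← hζ.card_primitiveRoots, ← Finset.prod_const]
  refine Finset.prod_congr rfl fun μ hμ => ?_
  rw [eval_sub, eval_X, eval_C, hnorm μ hμ]

theorem norm_sub_one_pos {n : ℕ} (hn : 1 ≤ n) {ζ : Fbar p k}
    (hζ : IsPrimitiveRoot ζ (p ^ n)) : 0 < ‖ζ - 1‖ := by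
  rw [norm_pos_iff, sub_ne_zero]
  exact hζ.ne_one (Nat.one_lt_pow (by omega) (Fact.out : p.Prime).one_lt)

theorem totient_prime_pow_pos (n : ℕ) : 0 < (p ^ n).totient :=
  Nat.totient_pos.2 (pow_pos (Fact.out : p.Prime).pos n)

theorem norm_sub_one_lt_one {n : ℕ} (hn : 1 ≤ n) {ζ : Fbar p k}
    (hζ : IsPrimitiveRoot ζ (p ^ n)) : ‖ζ - 1‖ < 1 := by
  have hp1 : (1 : ℝ) < p := by exact_mod_cast (Fact.out : p.Prime).one_lt
  by_contra! h
  have h1 := one_le_pow₀ (n := (p ^ n).totient) h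
  rw [norm_sub_one_pow_totient hn hζ] at h1
  exact absurd (inv_lt_one_of_one_lt₀ hp1) (not_lt.2 h1)

theorem inv_le_norm_sub_one {n : ℕ} (hn : 1 ≤ n) {ζ : Fbar p k}
    (hζ : IsPrimitiveRoot ζ (p ^ n)) : (p : ℝ)⁻¹ ≤ ‖ζ - 1‖ := by
  rw [← norm_sub_one_pow_totient hn hζ]
  exact pow_le_of_le_one (norm_nonneg _) (norm_sub_one_lt_one hn hζ).le
    (totient_prime_pow_pos n).ne'

theorem norm_sub_one_pow_eq {m j : ℕ} (hm : 1 ≤ m) {ζ : Fbar p k}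
    (hζ : IsPrimitiveRoot ζ (p ^ (m + j))) : ‖ζ - 1‖ ^ p ^ j = ‖ζ ^ p ^ j - 1‖ := by
  have hp : p.Prime := Fact.out
  have hζm : IsPrimitiveRoot (ζ ^ p ^ j) (p ^ m) :=
    hζ.pow (pow_pos hp.pos _) (by rw [← pow_add, add_comm])
  refine (pow_left_inj₀ (by positivity) (norm_nonneg _) (totient_prime_pow_pos (p := p) m).ne').1 ?_
  rw [norm_sub_one_pow_totient hm hζm, ← norm_sub_one_pow_totient (by omega) hζ, ← pow_mul]
  congr 1
  rw [Nat.totient_prime_pow hp (by omega), Nat.totient_prime_pow hp (by omega), ← mul_assoc,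
    ← pow_add]
  congr 2
  omega

theorem exists_norm_algebraMap_eq_zpow {n : ℕ} (hn : 1 ≤ n) {ζ : Fbar p k}
    (hζ : IsPrimitiveRoot ζ (p ^ n)) (b : F p k) (hb : b ≠ 0) :
    ∃ i : ℤ, ‖algebraMap (F p k) (Fbar p k) b‖ = ‖ζ - 1‖ ^ (((p ^ n).totient : ℤ) * i) := by
  obtain ⟨i, hi⟩ := exists_norm_eq_zpow p k b hb
  exact ⟨i, by rw [norm_algebraMap_Fbar, hi, zpow_mul, zpow_natCast,
    norm_sub_one_pow_totient hn hζ]⟩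

variable (p k) in
/-- The field `F(μ_{p^n})`. -/
def cyclotomicLevel (n : ℕ) : IntermediateField (F p k) (Fbar p k) :=
  adjoin (F p k) {ζ : Fbar p k | ζ ^ p ^ n = 1}

omit [PerfectRing k p] in
theorem mem_cyclotomicLevel {n : ℕ} {ζ : Fbar p k} (h : ζ ^ p ^ n = 1) :
    ζ ∈ cyclotomicLevel p k n := subset_adjoin _ _ h

omit [PerfectRing k p] in
theorem cyclotomicLevel_eq_adjoin {n : ℕ} {ζ : Fbar p k} (hζ : IsPrimitiveRoot ζ (p ^ n)) :
    cyclotomicLevel p k n = (F p k)⟮ζ⟯ := by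
  have : NeZero (p ^ n) := ⟨pow_ne_zero n (Fact.out : p.Prime).ne_zero⟩
  refine le_antisymm (adjoin_le_iff.2 ?_)
    ((adjoin_simple_le_iff).2 (mem_cyclotomicLevel hζ.pow_eq_one))
  intro μ hμ
  obtain ⟨i, -, rfl⟩ := hζ.eq_pow_of_pow_eq_one hμ
  exact pow_mem (mem_adjoin_simple_self _ ζ) i

omit [PerfectRing k p] in
theorem cyclotomicLevel_mono : Monotone (cyclotomicLevel p k) := by
  intro m n hmn
  refine adjoin.mono _ _ _ fun ζ hζ => ?_
  change ζ ^ p ^ n = 1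
  rw [← Nat.add_sub_cancel' hmn, pow_add, pow_mul, show ζ ^ p ^ m = 1 from hζ, one_pow]

omit [PerfectRing k p] in
theorem exists_aeval_eq_of_mem_cyclotomicLevel {n : ℕ} {ζ : Fbar p k}
    (hζ : IsPrimitiveRoot ζ (p ^ n)) {z : Fbar p k} (hz : z ∈ cyclotomicLevel p k n) :
    ∃ P : (F p k)[X], aeval ζ P = z := by
  rw [cyclotomicLevel_eq_adjoin hζ, ← mem_toSubalgebra,
    adjoin_simple_toSubalgebra_of_isAlgebraic (Algebra.IsAlgebraic.isAlgebraic ζ)] at hz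
  exact Algebra.adjoin_mem_exists_aeval _ _ hz

/-- Total ramification: orthogonality over F shows that ζ - 1 generates the value group of the
level. -/
theorem exists_norm_eq_zpow_of_mem_cyclotomicLevel {n : ℕ} (hn : 1 ≤ n) {ζ : Fbar p k}
    (hζ : IsPrimitiveRoot ζ (p ^ n)) {z : Fbar p k} (hz : z ∈ cyclotomicLevel p k n)
    (hz0 : z ≠ 0) : ∃ i : ℤ, ‖z‖ = ‖ζ - 1‖ ^ i := by
  obtain ⟨P, rfl⟩ := exists_aeval_eq_of_mem_cyclotomicLevel hζ hz
  have hM : (cyclotomic (p ^ n) (F p k)).Monic := cyclotomic.monic _ _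
  have hroot : aeval ζ (cyclotomic (p ^ n) (F p k)) = 0 := by
    rw [aeval_def, eval₂_eq_eval_map, map_cyclotomic]
    exact hζ.isRoot_cyclotomic (pow_pos (Fact.out : p.Prime).pos n)
  set Q := P %ₘ cyclotomic (p ^ n) (F p k) with hQ
  have hQP : aeval ζ Q = aeval ζ P := by
    conv_rhs => rw [← modByMonic_add_div P (cyclotomic (p ^ n) (F p k))]
    rw [map_add, map_mul, hroot, zero_mul, add_zero]
  have hQdeg : Q.natDegree < (p ^ n).totient := by
    rw [← natDegree_cyclotomic (p ^ n) (F p k)]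
    refine natDegree_modByMonic_lt _ hM fun h => ?_
    have := totient_prime_pow_pos (p := p) n
    rw [← natDegree_cyclotomic (p ^ n) (F p k), h, natDegree_one] at this
    exact lt_irrefl _ this
  rw [← hQP] at hz0 ⊢
  have e : aeval ζ Q = aeval (ζ - 1) (taylor 1 Q) := by rw [aeval_taylor_one, sub_add_cancel]
  rw [e] at hz0 ⊢
  refine exists_norm_aeval_eq_zpow (norm_sub_one_pos hn hζ) (norm_sub_one_lt_one hn hζ)
    (exists_norm_algebraMap_eq_zpow hn hζ) ?_ ?_
  · rwa [natDegree_taylor]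
  · rintro h
    rw [h, map_zero] at hz0
    exact hz0 rfl

/-- The loss is ‖ζ - 1‖^(p^j) = ‖ζ^(p^j) - 1‖ ≥ 1/p. It depends only on level m, whence a constant
independent of j. -/
theorem norm_coeff_zero_le_of_level {m j : ℕ} (hm : 1 ≤ m) {ζ : Fbar p k}
    (hζ : IsPrimitiveRoot ζ (p ^ (m + j))) {P : (cyclotomicLevel p k m)[X]}
    (hP : P.natDegree < p ^ j) : ‖(P.coeff 0 : Fbar p k)‖ ≤ p * ‖aeval ζ P‖ := by
  have hp : p.Prime := Fact.out
  have hζm : IsPrimitiveRoot (ζ ^ p ^ j) (p ^ m) :=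
    hζ.pow (pow_pos hp.pos _) (by rw [← pow_add, add_comm])
  have h := norm_coeff_zero_le (norm_sub_one_pos (by omega) hζ)
    (norm_sub_one_lt_one (by omega) hζ) (N := p ^ j) (P := P) ?_ hP
  · rw [norm_sub_one_pow_eq hm hζ] at h
    have hp0 : (0 : ℝ) < p := by exact_mod_cast hp.pos
    rw [← inv_mul_le_iff₀ hp0]
    exact (mul_le_mul_of_nonneg_right (inv_le_norm_sub_one hm hζm) (norm_nonneg _)).trans h
  · intro b hb
    obtain ⟨i, hi⟩ := exists_norm_eq_zpow_of_mem_cyclotomicLevel hm hζm b.2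
      (fun h => hb (Subtype.ext h))
    refine ⟨i, ?_⟩
    rw [zpow_mul, zpow_natCast, norm_sub_one_pow_eq hm hζ]
    exact hi

/-- The normalised trace of an element of a cyclotomic level to a lower one, with its bounds. -/
theorem exists_normalizedTrace {m n : ℕ} (hm : 1 ≤ m) (hmn : m ≤ n) {z : Fbar p k}
    (hz : z ∈ cyclotomicLevel p k n) :
    ∃ b : Fbar p k, (∀ a ∈ cyclotomicLevel p k m, ‖b - a‖ ≤ p * ‖z - a‖) ∧
      ∀ g : Gal(Fbar p k/F p k), (∀ a ∈ cyclotomicLevel p k m, g a = a) →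
        ∀ c : F p k, ‖(1 - algebraMap (F p k) (Fbar p k) c) * b‖
          ≤ p * ‖g z - algebraMap (F p k) (Fbar p k) c * z‖ := by
  have hp : p.Prime := Fact.out
  obtain ⟨j, rfl⟩ := Nat.exists_eq_add_of_le hmn
  obtain ⟨ζ, hζ⟩ := exists_isPrimitiveRoot p k (m + j)
  have : NeZero (p ^ (m + j)) := ⟨pow_ne_zero _ hp.ne_zero⟩
  have hq : 0 < p ^ j := pow_pos hp.pos j
  have hζm : IsPrimitiveRoot (ζ ^ p ^ j) (p ^ m) :=
    hζ.pow (pow_pos hp.pos _) (by rw [← pow_add, add_comm])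
  set ω : cyclotomicLevel p k m := ⟨ζ ^ p ^ j, mem_cyclotomicLevel hζm.pow_eq_one⟩ with hω
  have hζω : ζ ^ p ^ j = algebraMap (cyclotomicLevel p k m) (Fbar p k) ω := rfl
  obtain ⟨P₀, hP₀⟩ := exists_aeval_eq_of_mem_cyclotomicLevel hζ hz
  obtain ⟨P, hP, hPz⟩ : ∃ P : (cyclotomicLevel p k m)[X], P.natDegree < p ^ j ∧ aeval ζ P = z := by
    refine ⟨_, natDegree_modByMonic_X_pow_sub_C_lt hq ω
      (P₀.map (algebraMap (F p k) (cyclotomicLevel p k m))), ?_⟩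
    rw [aeval_modByMonic_X_pow_sub_C hζω, aeval_map_algebraMap, hP₀]
  -- The normalised trace kills ζ^i for 0 < i < p^j, so it is the constant coefficient of z written
  -- in powers of ζ over level m.
  refine ⟨(P.coeff 0 : Fbar p k), ?_, ?_⟩
  · intro a ha
    have hdeg : (P - Polynomial.C (⟨a, ha⟩ : cyclotomicLevel p k m)).natDegree < p ^ j := by
      rwa [natDegree_sub_C]
    have h := norm_coeff_zero_le_of_level hm hζ hdeg
    rw [map_sub, hPz, aeval_C, coeff_sub, coeff_C_zero] at h
    exact h
  · intro g hg c
    have hgζ : IsPrimitiveRoot (g ζ) (p ^ (m + j)) := hζ.map_of_injective g.injective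
    obtain ⟨e, -, he, heζ⟩ := (hζ.isPrimitiveRoot_iff).1 hgζ
    have heq : e.Coprime (p ^ j) := he.coprime_dvd_right (pow_dvd_pow p (by omega))
    have he0 : 0 < e := by
      refine Nat.pos_of_ne_zero fun h => ?_
      rw [h, Nat.coprime_zero_left] at he
      have := Nat.one_lt_pow (n := m + j) (by omega) hp.one_lt
      omega
    have hgz : g z = aeval ζ (expand _ e P) := by
      rw [expand_aeval, heζ, ← hPz, aeval_eq_sum_range, aeval_eq_sum_range, map_sum]
      refine Finset.sum_congr rfl fun i _ => ?_
      rw [Algebra.smul_def, Algebra.smul_def, map_mul, map_pow]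
      congr 1
      exact hg _ (P.coeff i).2
    -- The reduced polynomial of g z - c z has constant coefficient (1 - c) * P.coeff 0.
    set R := expand _ e P %ₘ (X ^ p ^ j - Polynomial.C ω) with hR
    set c' : cyclotomicLevel p k m := algebraMap (F p k) _ c with hc'
    have hdeg : (R - Polynomial.C c' * P).natDegree < p ^ j :=
      (natDegree_sub_le _ _).trans_lt
        (max_lt (natDegree_modByMonic_X_pow_sub_C_lt hq ω _) ((natDegree_C_mul_le _ _).trans_lt hP))
    have h := norm_coeff_zero_le_of_level hm hζ hdeg
    rw [map_sub, hR, aeval_modByMonic_X_pow_sub_C hζω, ← hgz, map_mul, hPz, aeval_C, coeff_sub, coeff_C_mul,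
      coeff_zero_expand_modByMonic hq ω hP heq he0] at h
    rw [sub_mul, one_mul]
    exact h

end Cyclotomic
end PadicHodge
end

/-! ### Invariants and eigenvectors in the completion. -/

noncomputable section
namespace PadicHodge

section Completion

open IntermediateField

variable {p : ℕ} [Fact p.Prime] {k : Type*} [Field k] [CharP k p] [PerfectRing k p]

/-- The descent to F applies automorphisms that need not fix K, so the whole group over F has to act
on C. -/
instance : UniformContinuousConstSMul Gal(Fbar p k/F p k) (Fbar p k) where
  uniformContinuous_const_smul g :=
    (AddMonoidHomClass.isometry_of_norm (DistribSMul.toAddMonoidHom (Fbar p k) g)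
      (norm_galois_base p k g)).uniformContinuous

theorem base_smul_coe (g : Gal(Fbar p k/F p k)) (x : Fbar p k) :
    g • (x : C p k) = ((g x : Fbar p k) : C p k) :=
  (UniformSpace.Completion.coe_smul g x).symm

theorem base_smul_mul (g : Gal(Fbar p k/F p k)) (x y : C p k) :
    g • (x * y) = (g • x) * (g • y) := by
  induction x, y using UniformSpace.Completion.induction_on₂ with
  | hp =>
    exact isClosed_eq (continuous_mul.const_smul g)
      ((continuous_fst.const_smul g).mul (continuous_snd.const_smul g))
  | ih x y =>
    rw [← UniformSpace.Completion.coe_mul, base_smul_coe, base_smul_coe, base_smul_coe,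
      map_mul, UniformSpace.Completion.coe_mul]

theorem norm_base_smul (g : Gal(Fbar p k/F p k)) (x : C p k) : ‖g • x‖ = ‖x‖ := by
  induction x using UniformSpace.Completion.induction_on with
  | hp => exact isClosed_eq (continuous_id.const_smul g).norm continuous_norm
  | ih x => rw [base_smul_coe, UniformSpace.Completion.norm_coe, UniformSpace.Completion.norm_coe,
      norm_galois_base]

instance : IsUltrametricDist (C p k) :=
  IsUltrametricDist.isUltrametricDist_of_forall_norm_add_le_max_norm fun x y => by
    induction x, y using UniformSpace.Completion.induction_on₂ with
    | hp => exact isClosed_le continuous_add.norm (continuous_fst.norm.max continuous_snd.norm)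
    | ih x y =>
      rw [← UniformSpace.Completion.coe_add, UniformSpace.Completion.norm_coe,
        UniformSpace.Completion.norm_coe, UniformSpace.Completion.norm_coe]
      exact IsUltrametricDist.norm_add_le_max x y

variable (p k) in
/-- The embedding of `F` into `C`. -/
def toC : F p k →+* C p k :=
  (UniformSpace.Completion.coeRingHom (α := Fbar p k)).comp (algebraMap (F p k) (Fbar p k))

theorem toC_apply (c : F p k) : toC p k c = ((algebraMap (F p k) (Fbar p k) c : Fbar p k) : C p k) :=
  rfl

theorem base_smul_toC (g : Gal(Fbar p k/F p k)) (c : F p k) : g • toC p k c = toC p k c := by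
  rw [toC_apply, base_smul_coe, g.commutes]

theorem norm_toC (c : F p k) : ‖toC p k c‖ = ‖c‖ := by
  rw [toC_apply, UniformSpace.Completion.norm_coe, norm_algebraMap_Fbar]

variable (p k) in
/-- The field `F(μ_{p^∞})`. -/
def cyclotomicTop : IntermediateField (F p k) (Fbar p k) := ⨆ n, cyclotomicLevel p k n

theorem exists_coe_near (y : C p k) {ε : ℝ} (hε : 0 < ε) :
    ∃ α : Fbar p k, ‖y - (α : C p k)‖ < ε := by
  obtain ⟨α, hα⟩ := (UniformSpace.Completion.denseRange_coe (α := Fbar p k)).exists_dist_lt y hε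
  exact ⟨α, by rwa [← dist_eq_norm]⟩

omit [PerfectRing k p] in
theorem mem_cyclotomicTop {z : Fbar p k} :
    z ∈ cyclotomicTop p k ↔ ∃ n, z ∈ cyclotomicLevel p k n := by
  rw [← SetLike.mem_coe, cyclotomicTop,
    coe_iSup_of_directed (cyclotomicLevel_mono (p := p) (k := k)).directed_le, Set.mem_iUnion]
  rfl

/-- Elements of `C` fixed by `Gal(Fbar/F(μ_{p^∞}))` are limits of elements of `F(μ_{p^∞})`. -/
theorem exists_cyclotomicLevel_near {y : C p k}
    (hy : ∀ h ∈ (cyclotomicTop p k).fixingSubgroup, h • y = y) {ε : ℝ} (hε : 0 < ε) :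
    ∃ n, ∃ z ∈ cyclotomicLevel p k n, ‖y - (z : C p k)‖ ≤ ε := by
  have hp : p.Prime := Fact.out
  have hp1 : (1 : ℝ) < p := by exact_mod_cast hp.one_lt
  have hp2 : (1 : ℝ) ≤ (p : ℝ) ^ 2 := one_le_pow₀ hp1.le
  have hε' : 0 < ε / (p : ℝ) ^ 2 := by positivity
  obtain ⟨α, hα⟩ := exists_coe_near y hε'
  have hconj : ∀ g : Fbar p k ≃ₐ[cyclotomicTop p k] Fbar p k, ‖g α - α‖ ≤ ε / (p : ℝ) ^ 2 := by
    intro g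
    set h : Gal(Fbar p k/F p k) := g.restrictScalars (F p k) with hh
    have hfix : h ∈ (cyclotomicTop p k).fixingSubgroup :=
      (mem_fixingSubgroup_iff _ _).2 fun x hx => g.commutes ⟨x, hx⟩
    have e : ((g α - α : Fbar p k) : C p k) = h • ((α : C p k) - y) + (y - α) := by
      rw [smul_sub, hy h hfix, base_smul_coe, UniformSpace.Completion.coe_sub]
      exact (sub_add_sub_cancel _ _ _).symm
    rw [← UniformSpace.Completion.norm_coe, e]
    refine (IsUltrametricDist.norm_add_le_max _ _).trans (max_le ?_ hα.le)
    rw [norm_base_smul, norm_sub_rev]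
    exact hα.le
  obtain ⟨a, ha⟩ := exists_approx_of_conjugates_near (L := cyclotomicTop p k) hp (norm_p_Fbar p k)
    (fun g x => norm_galois_base p k (g.restrictScalars (F p k)) x) hconj
  obtain ⟨n, hn⟩ := mem_cyclotomicTop.1 a.2
  refine ⟨n, a, hn, ?_⟩
  rw [mul_div_cancel₀ _ (by positivity)] at ha
  rw [← sub_add_sub_cancel y (α : C p k) (a : Fbar p k)]
  refine (IsUltrametricDist.norm_add_le_max _ _).trans (max_le (hα.le.trans ?_) ?_)
  · exact div_le_self hε.le hp2
  · rw [← UniformSpace.Completion.coe_sub, UniformSpace.Completion.norm_coe]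
    exact ha

/-- A nonzero element of `C` fixed by `Gal(Fbar/F(μ_{p^∞}))` has no eigenvalue other than `1` for
elements that fix a sufficiently large cyclotomic level. -/
theorem exists_level_eigenvalue_eq_one {y : C p k} (hy0 : y ≠ 0)
    (hy : ∀ h ∈ (cyclotomicTop p k).fixingSubgroup, h • y = y) :
    ∃ m, ∀ g ∈ (cyclotomicLevel p k m).fixingSubgroup, ∀ c : F p k,
      g • y = toC p k c * y → c = 1 := by
  have hp : p.Prime := Fact.out
  have hp0 : (0 : ℝ) < p := by exact_mod_cast hp.pos
  have hynorm : 0 < ‖y‖ := norm_pos_iff.2 hy0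
  have hp1 : (1 : ℝ) < p := by exact_mod_cast hp.one_lt
  -- The trace costs a factor p, so precision ‖y‖/p² still leaves the trace b strictly within ‖y‖ of
  -- y, which forces ‖y‖ ≤ ‖b‖.
  obtain ⟨m₀, z, hz₀, hyz⟩ := exists_cyclotomicLevel_near hy (ε := ‖y‖ / (p * p)) (by positivity)
  set m := max m₀ 1
  have hz : z ∈ cyclotomicLevel p k m := cyclotomicLevel_mono (le_max_left _ _) hz₀
  refine ⟨m, fun g hg c hgc => ?_⟩
  have hgfix : ∀ a ∈ cyclotomicLevel p k m, g a = a := fun a ha =>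
    (mem_fixingSubgroup_iff _ _).1 hg a ha
  have hlt : ‖y‖ / (p * p) * p < ‖y‖ := by
    rw [div_mul_eq_mul_div, div_lt_iff₀ (by positivity)]
    nlinarith [mul_pos hynorm hp0]
  have hc1 : ‖toC p k c‖ = 1 := by
    have := congrArg norm hgc
    rw [norm_base_smul, norm_mul] at this
    exact (mul_eq_right₀ hynorm.ne').1 this.symm
  -- An approximant z' of y within δ is an eigenvector of g up to δ, and the trace turns this into a
  -- bound on (1 - c) * b. Since δ is arbitrary, c = 1.
  have key : ∀ δ : ℝ, 0 < δ → ‖1 - c‖ * ‖y‖ ≤ p * δ := by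
    intro δ hδ
    obtain ⟨n₀, z', hz'₀, hyz'⟩ := exists_cyclotomicLevel_near hy
      (ε := min δ (‖y‖ / (p * p))) (by positivity)
    have hz' : z' ∈ cyclotomicLevel p k (max n₀ m) :=
      cyclotomicLevel_mono (le_max_left _ _) hz'₀
    obtain ⟨b, hb1, hb2⟩ := exists_normalizedTrace (le_max_right m₀ 1) (le_max_right n₀ m) hz'
    have hzz' : ‖z' - z‖ ≤ ‖y‖ / (p * p) := by
      rw [← UniformSpace.Completion.norm_coe, UniformSpace.Completion.coe_sub,
        ← sub_add_sub_cancel _ y]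
      refine (IsUltrametricDist.norm_add_le_max _ _).trans (max_le ?_ hyz)
      rw [norm_sub_rev]
      exact hyz'.trans (min_le_right _ _)
    have hbz : ‖b - z‖ < ‖y‖ := by
      refine (hb1 z hz).trans_lt (lt_of_le_of_lt ?_ hlt)
      rw [mul_comm]
      exact mul_le_mul_of_nonneg_right hzz' hp0.le
    have hyb : ‖y - (b : C p k)‖ < ‖y‖ := by
      rw [← sub_add_sub_cancel y (z : C p k) (b : C p k)]
      refine (IsUltrametricDist.norm_add_le_max _ _).trans_lt (max_lt (hyz.trans_lt ?_) ?_)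
      · refine lt_of_le_of_lt ?_ hlt
        exact le_mul_of_one_le_right (by positivity) hp1.le
      · rw [← UniformSpace.Completion.coe_sub, UniformSpace.Completion.norm_coe, norm_sub_rev]
        exact hbz
    have hb : ‖y‖ ≤ ‖b‖ := by
      by_contra! h
      have h1 : ‖(y - (b : C p k)) + b‖ < ‖y‖ := by
        refine (IsUltrametricDist.norm_add_le_max _ _).trans_lt (max_lt hyb ?_)
        rwa [UniformSpace.Completion.norm_coe]
      rw [sub_add_cancel] at h1
      exact lt_irrefl _ h1
    have h2 := hb2 g hgfix c
    have hgz : ‖g z' - algebraMap (F p k) (Fbar p k) c * z'‖ ≤ δ := by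
      have e : ((g z' - algebraMap (F p k) (Fbar p k) c * z' : Fbar p k) : C p k)
          = g • ((z' : C p k) - y) + toC p k c * (y - z') := by
        rw [smul_sub, hgc, base_smul_coe, UniformSpace.Completion.coe_sub,
          UniformSpace.Completion.coe_mul, toC_apply]
        ring
      rw [← UniformSpace.Completion.norm_coe, e]
      refine (IsUltrametricDist.norm_add_le_max _ _).trans (max_le ?_ ?_)
      · rw [norm_base_smul, norm_sub_rev]
        exact hyz'.trans (min_le_left _ _)
      · rw [norm_mul, hc1, one_mul]
        exact hyz'.trans (min_le_left _ _)
    rw [norm_mul, ← map_one (algebraMap (F p k) (Fbar p k)), ← map_sub,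
      norm_algebraMap_Fbar] at h2
    calc ‖1 - c‖ * ‖y‖ ≤ ‖1 - c‖ * ‖b‖ := mul_le_mul_of_nonneg_left hb (norm_nonneg _)
      _ ≤ _ := h2
      _ ≤ p * δ := mul_le_mul_of_nonneg_left hgz hp0.le
  by_contra hc
  have hpos : 0 < ‖1 - c‖ := norm_pos_iff.2 (sub_ne_zero.2 (Ne.symm hc))
  have h := key (‖1 - c‖ * ‖y‖ / (p * p)) (by positivity)
  rw [← mul_div_assoc, mul_div_mul_left _ _ hp0.ne', le_div_iff₀ hp0] at h
  nlinarith [mul_pos hpos hynorm]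

end Completion
end PadicHodge
end

/-! ### Descent from K to F and openness of the kernel. -/

noncomputable section

/-- The product of the translates of `x` under coset representatives of `S ⊓ N` in `S`. -/
theorem exists_smul_invariant_of_finiteIndex {G A : Type*} [Group G] [Field A]
    [MulSemiringAction G A] (S N : Subgroup G) [S.Normal] [N.Normal] [N.FiniteIndex] {x : A}
    (hx0 : x ≠ 0) (hx : ∀ h ∈ S ⊓ N, h • x = x) :
    ∃ (d : ℕ) (y : A), d ≠ 0 ∧ y ≠ 0 ∧ (∀ s ∈ S, s • y = y) ∧
      ∀ g ∈ N, ∀ a : A, (∀ σ : G, σ • a = a) → g • x = a * x → g • y = a ^ d * y := by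
  have : Fintype (S ⧸ N.subgroupOf S) := Fintype.ofFinite _
  set f : S ⧸ N.subgroupOf S → A := fun q => ((q.out : S) : G) • x with hf
  have hfmk : ∀ σ : S, (σ : G) • x = f σ := by
    intro σ
    obtain ⟨h, hh⟩ := QuotientGroup.mk_out_eq_mul (N.subgroupOf S) σ
    rw [hf]
    change _ = (((σ : S ⧸ N.subgroupOf S).out : S) : G) • x
    rw [hh, Subgroup.coe_mul, mul_smul, hx _ ⟨h.1.2, Subgroup.mem_subgroupOf.1 h.2⟩]
  refine ⟨Fintype.card (S ⧸ N.subgroupOf S), ∏ q, f q, Fintype.card_ne_zero, ?_, ?_, ?_⟩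
  · refine Finset.prod_ne_zero_iff.2 fun q _ => ?_
    rw [hf]
    exact (smul_ne_zero_iff_ne _).2 hx0
  · intro s hs
    rw [Finset.smul_prod']
    refine Fintype.prod_equiv (MulAction.toPerm (⟨s, hs⟩ : S)) _ _ fun q => ?_
    have hq : MulAction.toPerm (⟨s, hs⟩ : S) q
        = ((⟨s, hs⟩ * q.out : S) : S ⧸ N.subgroupOf S) := by
      conv_lhs => rw [← QuotientGroup.out_eq' q]
      rfl
    rw [hq, ← hfmk, Subgroup.coe_mul, mul_smul]
  · intro g hg a ha hgx
    rw [Finset.smul_prod', ← Finset.card_univ, ← Finset.prod_const, ← Finset.prod_mul_distrib]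
    refine Finset.prod_congr rfl fun q _ => ?_
    rw [hf]
    set σ : G := ((q.out : S) : G) with hσ
    have hσS : σ ∈ S := q.out.2
    -- Both subgroups are normal, so this commutator lies in their intersection and fixes x; hence g
    -- scales each translate σ x by the same a.
    have hmem : σ⁻¹ * g * σ * g⁻¹ ∈ S ⊓ N := by
      constructor
      · rw [mul_assoc, mul_assoc, ← mul_assoc g]
        exact S.mul_mem (S.inv_mem hσS) (Subgroup.Normal.conj_mem inferInstance σ hσS g)
      · refine N.mul_mem ?_ (N.inv_mem hg)
        simpa using Subgroup.Normal.conj_mem (inferInstance : N.Normal) g hg σ⁻¹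
    calc g • σ • x = σ • (σ⁻¹ * g * σ * g⁻¹) • g • x := by
          rw [smul_smul, smul_smul, smul_smul]; congr 1; group
      _ = a * σ • x := by
          rw [hgx, smul_mul', ha, hx _ hmem, smul_mul', ha]

/-- If c ≠ 1, the powers c^i with i < d sum to 0, so d is minus the sum of the c^i - 1, each of norm
at most ‖c - 1‖. -/
theorem eq_one_of_pow_eq_one_of_norm_lt {A : Type*} [NormedField A] [IsUltrametricDist A] {c : A}
    {d : ℕ} (hd : d ≠ 0) (hc : c ^ d = 1) (hlt : ‖c - 1‖ < ‖(d : A)‖) : c = 1 := by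
  by_contra hne
  have hnc : ‖c‖ = 1 := by
    have := congrArg norm hc
    rw [norm_pow, norm_one] at this
    exact (pow_eq_one_iff_of_nonneg (norm_nonneg _) hd).1 this
  have hsum : ∑ i ∈ Finset.range d, c ^ i = 0 := by
    have h := geom_sum_mul c d
    rw [hc, sub_self, mul_eq_zero] at h
    exact h.resolve_right (sub_ne_zero.2 hne)
  have hd' : (d : A) = -∑ i ∈ Finset.range d, (c ^ i - 1) := by
    rw [Finset.sum_sub_distrib, hsum]; simp
  refine absurd hlt (not_lt.2 ?_)
  rw [hd', norm_neg]
  refine IsUltrametricDist.norm_sum_le_of_forall_le_of_nonneg (norm_nonneg _) fun i _ => ?_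
  rw [← geom_sum_mul, norm_mul]
  refine mul_le_of_le_one_left (norm_nonneg _) ?_
  refine IsUltrametricDist.norm_sum_le_of_forall_le_of_nonneg zero_le_one fun j _ => ?_
  rw [norm_pow, hnc, one_pow]

namespace PadicHodge

open IntermediateField

variable {p : ℕ} [Fact p.Prime] {k : Type*} [Field k] [CharP k p] [PerfectRing k p]

omit [PerfectRing k p] in
instance cyclotomicLevel_normal (n : ℕ) : Normal (F p k) (cyclotomicLevel p k n) := by
  rw [IntermediateField.normal_iff_forall_map_le]
  intro σ
  rw [cyclotomicLevel, IntermediateField.adjoin_map]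
  refine IntermediateField.adjoin.mono _ _ _ ?_
  rintro _ ⟨ζ, hζ, rfl⟩
  change σ ζ ^ p ^ n = 1
  rw [← map_pow, show ζ ^ p ^ n = 1 from hζ, map_one]

omit [PerfectRing k p] in
instance cyclotomicTop_normal : Normal (F p k) (cyclotomicTop p k) :=
  IntermediateField.normal_iSup _ _ _

instance : IsGalois (F p k) (cyclotomicTop p k) where

instance : MulSemiringAction Gal(Fbar p k/F p k) (C p k) where
  smul_one g := by
    rw [← UniformSpace.Completion.coe_one, base_smul_coe, map_one]
  smul_mul := base_smul_mul

variable (p k) in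
/-- The embedding of `ℤ_p` into `F`. -/
def padicIntToF : ℤ_[p] →+* F p k := (algebraMap (WittVector p k) (F p k)).comp (padicIntToWitt p k)

omit [PerfectRing k p] in
theorem padicIntToF_injective : Function.Injective (padicIntToF p k) := by
  refine (IsFractionRing.injective (WittVector p k) (F p k)).comp ?_
  exact (WittVector.map_injective _ (RingHom.injective _)).comp
    (WittVector.equiv p).symm.injective

variable (K : IntermediateField (F p k) (Fbar p k))

theorem restrictScalars_smul (g : G K) (x : C p k) :
    (AlgEquiv.restrictScalars (F p k) g : Gal(Fbar p k/F p k)) • x = g • x := by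
  induction x using UniformSpace.Completion.induction_on with
  | hp => exact isClosed_eq (continuous_const_smul _) (continuous_const_smul g)
  | ih x => rw [base_smul_coe, galois_smul_coe]; rfl

omit [PerfectRing k p] in
theorem mem_H_iff (g : G K) : g ∈ H K ↔ ∀ (n : ℕ) (ζ : Fbar p k), ζ ^ p ^ n = 1 → g ζ = ζ := by
  constructor
  · intro hg n ζ hζ
    refine (mem_fixingSubgroup_iff _ _).1 hg ζ ?_
    exact (le_iSup (Kn K) n) (subset_adjoin _ _ hζ)
  · intro h
    rw [H, ← Subgroup.zpowers_le, ← le_iff_le]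
    refine iSup_le fun n => adjoin_le_iff.2 fun ζ hζ => ?_
    rintro ⟨_, i, rfl⟩
    have hfix : g ∈ MulAction.stabilizer (G K) ζ := h n ζ hζ
    exact zpow_mem hfix i

variable [FiniteDimensional (F p k) K]

/-- A character of `G_K` trivial on `H_K` with a nonzero period in `C` has open kernel. -/
theorem isOpen_ker_of_eigenvector (ψ : G K →* ℤ_[p]ˣ) (hψ : ∀ h ∈ H K, ψ h = 1) {x : C p k}
    (hx0 : x ≠ 0) (hx : ∀ g : G K, g • x = (ψ g : ℤ_[p]) • x) :
    IsOpen (ψ.ker : Set (G K)) := by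
  set M := normalClosure (F p k) K (Fbar p k) with hM
  have hKM : K ≤ M := le_normalClosure K
  have : Finite (Gal(Fbar p k/F p k) ⧸ M.fixingSubgroup) :=
    Subgroup.quotient_finite_of_isOpen _ (fixingSubgroup_isOpen M)
  have : M.fixingSubgroup.FiniteIndex := Subgroup.finiteIndex_of_finite_quotient
  have hsmul : ∀ (a : ℤ_[p]) (y : C p k), a • y = toC p k (padicIntToF p k a) * y := fun a y =>
    Algebra.smul_def a y
  have hfix : ∀ h ∈ (cyclotomicTop p k).fixingSubgroup ⊓ M.fixingSubgroup, h • x = x := by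
    rintro h ⟨hh, hhM⟩
    set h' : G K := fixingSubgroupEquiv K ⟨h, fixingSubgroup_antitone hKM hhM⟩ with hh'
    have h1 : h • x = h' • x := (restrictScalars_smul K h' x)
    have h2 : h' ∈ H K := (mem_H_iff K h').2 fun n ζ hζ =>
      (mem_fixingSubgroup_iff _ _).1 hh ζ (mem_cyclotomicTop.2 ⟨n, mem_cyclotomicLevel hζ⟩)
    rw [h1, hx, hψ h' h2, Units.val_one, one_smul]
  obtain ⟨d, y, hd, hy0, hyS, hyN⟩ := exists_smul_invariant_of_finiteIndex
    (cyclotomicTop p k).fixingSubgroup M.fixingSubgroup hx0 hfix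
  obtain ⟨m, hm⟩ := exists_level_eigenvalue_eq_one hy0 hyS
  have hd0 : 0 < ‖(d : F p k)‖ := norm_pos_iff.2 (Nat.cast_ne_zero.2 hd)
  have hxn : 0 < ‖x‖ := norm_pos_iff.2 hx0
  -- If g fixes z, then (ψ(g) - 1)x has norm below ‖d‖ ‖x‖, so ψ(g) is close enough to 1 to separate
  -- it from the other d-th roots of unity.
  obtain ⟨z, hz⟩ := exists_coe_near x (mul_pos hd0 hxn)
  obtain ⟨ζ, hζ⟩ := exists_isPrimitiveRoot p k m
  obtain ⟨s, hs⟩ : M.FG := essFiniteType_iff.1 inferInstance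
  classical
  -- Elements of V fix z, the cyclotomic level m and the normal closure M of K.
  set V : Subgroup (G K) := ⨅ a ∈ insert z (insert ζ s), MulAction.stabilizer (G K) a with hV
  have hVopen : IsOpen (V : Set (G K)) := by
    rw [hV, Subgroup.coe_iInf]
    simp only [Subgroup.coe_iInf]
    exact isOpen_biInter_finset fun a _ => stabilizer_isOpen_of_isIntegral a
  refine Subgroup.isOpen_mono ?_ hVopen
  intro g hg
  have hgfix : ∀ a ∈ insert z (insert ζ s), g a = a := fun a ha => by
    have := (Subgroup.mem_iInf.1 (Subgroup.mem_iInf.1 hg a)) ha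
    exact this
  set g' : Gal(Fbar p k/F p k) := AlgEquiv.restrictScalars (F p k) g with hg'
  have hadj : ∀ T : Set (Fbar p k), (∀ a ∈ T, g a = a) → g' ∈ (adjoin (F p k) T).fixingSubgroup := by
    intro T hT
    rw [← Subgroup.zpowers_le, ← le_iff_le]
    refine adjoin_le_iff.2 fun a ha => ?_
    rintro ⟨_, i, rfl⟩
    have hfix : g' ∈ MulAction.stabilizer Gal(Fbar p k/F p k) a := hT a ha
    exact zpow_mem hfix i
  have hgM : g' ∈ M.fixingSubgroup := by
    rw [← hs]
    exact hadj _ fun a ha => hgfix a (by simp [Finset.mem_coe.1 ha])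
  have hgm : g' ∈ (cyclotomicLevel p k m).fixingSubgroup := by
    rw [cyclotomicLevel_eq_adjoin hζ]
    refine hadj _ fun a ha => hgfix a ?_
    rw [Set.mem_singleton_iff.1 ha]
    simp
  set c := padicIntToF p k (ψ g) with hc
  have hgx : g' • x = toC p k c * x := by rw [hg', restrictScalars_smul, hx, hsmul]
  have hgy := hyN g' hgM (toC p k c) (fun σ => base_smul_toC σ c) hgx
  rw [← map_pow] at hgy
  have hcd : c ^ d = 1 := hm g' hgm _ hgy
  have hnear : ‖c - 1‖ < ‖(d : F p k)‖ := by
    have e : toC p k (c - 1) * x = g' • (x - (z : C p k)) + ((z : C p k) - x) := by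
      rw [smul_sub, hgx, base_smul_coe, show g' z = z from hgfix z (by simp), map_sub, map_one]
      ring
    have h1 : ‖toC p k (c - 1) * x‖ < ‖(d : F p k)‖ * ‖x‖ := by
      rw [e]
      refine (IsUltrametricDist.norm_add_le_max _ _).trans_lt (max_lt ?_ ?_)
      · rwa [norm_base_smul]
      · rwa [norm_sub_rev]
    rw [norm_mul, norm_toC] at h1
    exact lt_of_mul_lt_mul_right h1 hxn.le
  have hc1 := eq_one_of_pow_eq_one_of_norm_lt hd hcd hnear
  rw [MonoidHom.mem_ker]
  refine Units.ext (padicIntToF_injective (k := k) ?_)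
  rw [Units.val_one, map_one]
  exact hc1

omit [FiniteDimensional (F p k) K]

theorem factorsThroughFiniteQuotient_of_isOpen_ker (ψ : G K →* ℤ_[p]ˣ)
    (hψ : ∀ h ∈ H K, ψ h = 1) (hopen : IsOpen (ψ.ker : Set (G K))) :
    FactorsThroughFiniteQuotient K ψ := by
  have hsurj : Function.Surjective (resΓ K) :=
    AlgEquiv.restrictNormalHom_surjective (F := K) (K₁ := Kinf K) (Fbar p k)
  have hker : (resΓ K).ker ≤ ψ.ker := by
    intro g hg
    rw [resΓ, restrictNormalHom_ker] at hg
    exact hψ g hg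
  set φ := (resΓ K).liftOfSurjective hsurj ⟨ψ, hker⟩ with hφ
  have hcomp : φ.comp (resΓ K) = ψ := MonoidHom.liftOfRightInverse_comp _ _ _ _
  have hcont : Continuous (resΓ K) := InfiniteGalois.restrictNormalHom_continuous (Kinf K)
  have : CompactSpace (Γ K) := hsurj.compactSpace hcont
  -- A continuous surjection from a compact space to a Hausdorff one is a quotient map, so openness
  -- of the kernel descends to Γ_K.
  have hquot := hcont.isClosedMap.isQuotientMap hcont hsurj
  have hNopen : IsOpen (φ.ker : Set (Γ K)) := by
    rw [← hquot.isOpen_preimage]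
    convert hopen using 1
    ext g
    rw [← hcomp]
    rfl
  refine ⟨φ.ker, inferInstance, hNopen, Subgroup.quotient_finite_of_isOpen _ hNopen,
    QuotientGroup.kerLift φ, ?_⟩
  rw [← hcomp]
  rfl

/-! ### The cyclotomic character has non-open kernel. -/

theorem cyclotomic_spec (g : G K) {n : ℕ} {ζ : Fbar p k} (hζ : ζ ^ p ^ n = 1) :
    g ζ = ζ ^ (PadicInt.toZModPow n (χ K g : ℤ_[p])).val := by
  have (i : ℕ) : NeZero (p ^ i) := ⟨pow_ne_zero i (Fact.out : p.Prime).ne_zero⟩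
  exact cyclotomicCharacter.spec p (MulSemiringAction.toRingAut (G K) (Fbar p k) g) ζ hζ

theorem χ_eq_one_iff (g : G K) : χ K g = 1 ↔ g ∈ H K := by
  have (i : ℕ) : NeZero (p ^ i) := ⟨pow_ne_zero i (Fact.out : p.Prime).ne_zero⟩
  rw [mem_H_iff]
  constructor
  · intro h n ζ hζ
    rw [cyclotomic_spec K g hζ, h, Units.val_one, map_one, ZMod.val_one_eq_one_mod,
      ← pow_eq_pow_mod 1 hζ, pow_one]
  · intro h
    refine Units.ext (PadicInt.ext_of_toZModPow.1 fun n => ?_)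
    obtain ⟨ζ, hζ⟩ := exists_isPrimitiveRoot p k n
    have hfin : IsOfFinOrder ζ :=
      isOfFinOrder_iff_pow_eq_one.2 ⟨p ^ n, pow_pos (Fact.out : p.Prime).pos n, hζ.pow_eq_one⟩
    have h1 := cyclotomic_spec K g hζ.pow_eq_one
    rw [h n ζ hζ.pow_eq_one] at h1
    nth_rewrite 1 [← pow_one ζ] at h1
    rw [hfin.pow_eq_pow_iff_modEq, ← hζ.eq_orderOf, ← ZMod.natCast_eq_natCast_iff] at h1
    rw [Units.val_one, map_one, ← ZMod.natCast_zmod_val (PadicInt.toZModPow n (χ K g : ℤ_[p])),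
      ← h1, Nat.cast_one]

/-- Orthogonality of the powers of ζ - 1 over F rules out a nonzero annihilating polynomial of
smaller degree. -/
theorem totient_le_natDegree_minpoly {n : ℕ} (hn : 1 ≤ n) {ζ : Fbar p k}
    (hζ : IsPrimitiveRoot ζ (p ^ n)) : (p ^ n).totient ≤ (minpoly (F p k) ζ).natDegree := by
  by_contra! hlt
  have h0 : Polynomial.taylor 1 (minpoly (F p k) ζ) = 0 := by
    refine eq_zero_of_aeval_eq_zero_of_orthogonal (norm_sub_one_pos hn hζ)
      (norm_sub_one_lt_one hn hζ) (exists_norm_algebraMap_eq_zpow hn hζ) ?_ ?_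
    · rwa [Polynomial.natDegree_taylor]
    · rw [aeval_taylor_one, sub_add_cancel, minpoly.aeval]
  rw [Polynomial.taylor_eq_zero] at h0
  exact minpoly.ne_zero (Algebra.IsIntegral.isIntegral ζ) h0

theorem not_isOpen_ker_χ [FiniteDimensional (F p k) K] : ¬ IsOpen ((χ K).ker : Set (G K)) := by
  intro hopen
  have hp : p.Prime := Fact.out
  -- An open kernel contains Gal(Fbar/E) with E finite over K. As the kernel is H_K, such an E
  -- contains every root of unity of p-power order.
  obtain ⟨E, hE, hEker⟩ := (krullTopology_mem_nhds_one_iff K (Fbar p k) _).1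
    (hopen.mem_nhds (one_mem (χ K).ker))
  have hfd : FiniteDimensional (F p k) E := FiniteDimensional.trans (F p k) K E
  have hmem : ∀ (n : ℕ) (ζ : Fbar p k), ζ ^ p ^ n = 1 → ζ ∈ E := by
    intro n ζ hζ
    rw [← InfiniteGalois.fixedField_fixingSubgroup E]
    rintro ⟨g, hg⟩
    exact (mem_H_iff K g).1 ((χ_eq_one_iff K g).1 (hEker hg)) n ζ hζ
  have : IsScalarTower (F p k) E (Fbar p k) := IsScalarTower.of_algebraMap_eq fun _ => rfl
  set D := Module.finrank (F p k) E with hD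
  -- At level D + 1 the degree is at least p^D * (p - 1), which exceeds D.
  obtain ⟨ζ, hζ⟩ := exists_isPrimitiveRoot p k (D + 1)
  have h1 := totient_le_natDegree_minpoly (by omega) hζ
  have h2 : (minpoly (F p k) ζ).natDegree ≤ D := by
    have := minpoly.natDegree_le (A := F p k) (⟨ζ, hmem _ ζ hζ.pow_eq_one⟩ : E)
    rwa [← minpoly.algebraMap_eq (B' := Fbar p k) (algebraMap E (Fbar p k)).injective] at this
  rw [Nat.totient_prime_pow hp (by omega), Nat.add_sub_cancel] at h1
  have h3 : D < p ^ D := Nat.lt_pow_self hp.one_lt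
  have h4 : p ^ D ≤ p ^ D * (p - 1) :=
    Nat.le_mul_of_pos_right _ (by have := hp.two_le; omega)
  omega

theorem H0_inv_eq (ψ : G K →* ℤ_[p]ˣ) : (H0 K ψ⁻¹ : Set (C p k))
    = {x : C p k | ∀ g : G K, g • x = (ψ g : ℤ_[p]) • x} := by
  ext x
  refine forall_congr' fun g => ?_
  change ((ψ⁻¹ g : ℤ_[p]ˣ) : ℤ_[p]) • (g • x) = x ↔ _
  rw [MonoidHom.inv_apply, ← Units.smul_def, inv_smul_eq_iff, Units.smul_def]

theorem H0_inv_eq_bot [FiniteDimensional (F p k) K] (ψ : G K →* ℤ_[p]ˣ)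
    (hψ : ∀ h ∈ H K, ψ h = 1) (hopen : ¬ IsOpen (ψ.ker : Set (G K))) : H0 K ψ⁻¹ = ⊥ := by
  refine (Submodule.eq_bot_iff _).2 fun x hx => ?_
  by_contra hx0
  have hx' : x ∈ (H0 K ψ⁻¹ : Set (C p k)) := hx
  rw [H0_inv_eq] at hx'
  exact hopen (isOpen_ker_of_eigenvector K ψ hψ hx0 hx')

end PadicHodge
end

open PadicHodge in
theorem mainTheorem6 (p : ℕ) [Fact p.Prime] (k : Type*) [Field k] [CharP k p] [PerfectRing k p]
    (K : IntermediateField (F p k) (Fbar p k)) [FiniteDimensional (F p k) K] :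
    (∀ ψ : G K →* ℤ_[p]ˣ, (∀ h ∈ H K, ψ h = 1) → ¬ FactorsThroughFiniteQuotient K ψ →
      (H0 K ψ⁻¹ : Set (C p k)) = {x : C p k | ∀ g : G K, g • x = (ψ g : ℤ_[p]) • x} ∧
      H0 K ψ⁻¹ = ⊥) ∧
    H0 K (χ K)⁻¹ = ⊥ ∧ H0 K (χ K) = ⊥ := by
  have hχ : ∀ h ∈ H K, χ K h = 1 := fun h hh => (χ_eq_one_iff K h).2 hh
  refine ⟨fun ψ hψ hfin => ⟨H0_inv_eq K ψ, H0_inv_eq_bot K ψ hψ fun hopen =>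
    hfin (factorsThroughFiniteQuotient_of_isOpen_ker K ψ hψ hopen)⟩,
    H0_inv_eq_bot K (χ K) hχ (not_isOpen_ker_χ K), ?_⟩
  have hker : (χ K)⁻¹.ker = (χ K).ker := by
    ext g
    rw [MonoidHom.mem_ker, MonoidHom.mem_ker, MonoidHom.inv_apply, inv_eq_one]
  -- The inverse of χ has the same kernel, so the general result applies to it as well.
  have h := H0_inv_eq_bot K (χ K)⁻¹ (fun h hh => by rw [MonoidHom.inv_apply, hχ h hh, inv_one])
    (by rw [hker]; exact not_isOpen_ker_χ K)
  have e : ((χ K)⁻¹)⁻¹ = χ K := MonoidHom.ext fun g => inv_inv (χ K g)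
  rwa [e] at h
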